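/- Let $(M_p)_{p\in\mathbb N_0}$ be a sequence of positive numbers with $M_0=1$ such that - (M.1) $M_p^2\le M_{p-1}M_{p+1}$ for all $p\ge 1$; - (M.2) there are $A,H>0$ with $M_p\le A H^p\min_{0\le q\le p}M_qM_{p-q}$ for all $p\ge 0$; - (M.3)'' there are $C,L>0$ with $p^{p/2}\le C L^p M_p$ for all $p\ge 0$ (with $0^0=1$). For $m>0$ let $\mathcal S^{M_p,m}(\mathbb R^d)$ be the Banach space of smooth functions $\varphi:\mathbb R^d\to\mathbb C$ with $$\|\varphi\|_{\mathcal S^{M_p},m}=\sup_{\alpha,\beta\in\mathbb N_0^d}\frac{m^{|\alpha|+|\beta|}}{M_{|\alpha|}M_{|\beta|}}\Big\|\prod_{i=1}^d(1+x_i^2)^{\beta_i/2}\,\varphi^{(\alpha)}(x)\Big\|_{L^\infty}<\infty .$$ Let $\mathcal S^{\{M_p\}}(\mathbb R^d)=\bigcup_{m>0}\mathcal S^{M_p,m}(\mathbb R^d)$ with the locally convex inductive limit topology, and let $\mathcal S^{\{M_p\}\prime}(\mathbb R^d)$ be its strong dual. For $\psi\in\mathcal S^{\{M_p\}}(\mathbb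 R^l)$ and $\varphi\in\mathcal S^{\{M_p\}}(\mathbb R^s)$ put $(\psi\otimes\varphi)(x,y)=\psi(x)\varphi(y)$, an element of $\mathcal S^{\{M_p\}}(\mathbb R^{l+s})$. **Theorem (Kernel theorem).** 1. For every jointly continuous bilinear functional $K$ on $\mathcal S^{\{M_p\}}(\mathbb R^l)\times\mathcal S^{\{M_p\}}(\mathbb R^s)$ there is exactly one continuous linear map $\mathcal K:\mathcal S^{\{M_p\}}(\mathbb R^s)\to\mathcal S^{\{M_p\}\prime}(\mathbb R^l)$ such that $$\langle\mathcal K\varphi,\psi\rangle=K(\psi,\varphi)\qquad\text{for all }\psi\in\mathcal S^{\{M_p\}}(\mathbb R^l),\ \varphi\in\mathcal S^{\{M_p\}}(\mathbb R^s).$$ In particular $\mathcal K\varphi_j\to0$ in $\mathcal S^{\{M_p\}\prime}(\mathbb R^l)$ whenever $\varphi_j\to0$ in $\mathcal S^{\{M_p\}}(\mathbb R^s)$. 2. Conversely, let $\mathcal K:\mathcal S^{\{M_p\}}(\mathbb R^s)\to\mathcal S^{\{M_p\}\prime}(\mathbb R^l)$ be a linear map such that $\mathcal K\varphi_j\to0$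 for every sequence $\varphi_j\to0$. Then there is a unique $K\in\mathcal S^{\{M_p\}\prime}(\mathbb R^{l+s})$ such that $$\langle\mathcal K\varphi,\psi\rangle=\langle K,\psi\otimes\varphi\rangle\qquad\text{for all }\psi\in\mathcal S^{\{M_p\}}(\mathbb R^l),\ \varphi\in\mathcal S^{\{M_p\}}(\mathbb R^s).$$ -/

import Mathlib

open Topology Filter
open scoped ENNReal ContDiff

namespace GelfandShilov

/-- A weight sequence `(M_p)`: positive numbers with `M_0 = 1`, subject to logarithmic convexity
(M.1), stability under ultradifferential operators (M.2) and the non-triviality condition (M.3)''. -/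
structure WeightSequence where
  /-- The sequence `p ↦ M_p`. -/
  seq : ℕ → ℝ
  seq_pos : ∀ p, 0 < seq p
  seq_zero : seq 0 = 1
  log_convex : ∀ p, 1 ≤ p → seq p ^ 2 ≤ seq (p - 1) * seq (p + 1)
  stable : ∃ A H : ℝ, 0 < A ∧ 0 < H ∧
    ∀ p q, q ≤ p → seq p ≤ A * H ^ p * (seq q * seq (p - q))
  nontrivial : ∃ C L : ℝ, 0 < C ∧ 0 < L ∧
    ∀ p : ℕ, (p : ℝ) ^ ((p : ℝ) / 2) ≤ C * L ^ p * seq p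

/-- The length `|α|` of a multi-index. -/
def len {d : ℕ} (α : Fin d → ℕ) : ℕ := ∑ i, α i

/-- The partial derivative `∂f/∂x_i`. -/
noncomputable def pderiv {d : ℕ} (i : Fin d) (f : (Fin d → ℝ) → ℂ) : (Fin d → ℝ) → ℂ :=
  fun x => lineDeriv ℝ f x (Pi.single i 1)

/-- The iterated partial derivative `f^(α) = ∂_1^{α_1} ⋯ ∂_d^{α_d} f`. -/
noncomputable def mderiv {d : ℕ} (α : Fin d → ℕ) (f : (Fin d → ℝ) → ℂ) : (Fin d → ℝ) → ℂ :=
  (List.finRange d).foldr (fun i g => (pderiv i)^[α i] g) f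

/-- The weight `(1 + x²)^{β/2} = ∏ i, (1 + x_i²)^{β_i/2}`. -/
noncomputable def wt {d : ℕ} (β : Fin d → ℕ) (x : Fin d → ℝ) : ℝ :=
  ∏ i, (1 + x i ^ 2) ^ ((β i : ℝ) / 2)

/-- The quantity `m^{|α|+|β|} / (M_{|α|} M_{|β|}) * |(1 + x²)^{β/2} f^(α)(x)|`. -/
noncomputable def term (M : WeightSequence) (m : ℝ) {d : ℕ} (f : (Fin d → ℝ) → ℂ)
    (α β : Fin d → ℕ) (x : Fin d → ℝ) : ℝ :=
  m ^ (len α + len β) / (M.seq (len α) * M.seq (len β)) * (wt β x * ‖mderiv α f x‖)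

/-- The norm `‖f‖_{S^{M_p}, m}`, as an extended real: the supremum over `α`, `β`, `x`. -/
noncomputable def gsNorm (M : WeightSequence) (m : ℝ) {d : ℕ} (f : (Fin d → ℝ) → ℂ) : ℝ≥0∞ :=
  ⨆ (α : Fin d → ℕ) (β : Fin d → ℕ) (x : Fin d → ℝ), ENNReal.ofReal (term M m f α β x)

lemma wt_nonneg {d : ℕ} (β : Fin d → ℕ) (x : Fin d → ℝ) : 0 ≤ wt β x :=
  Finset.prod_nonneg fun i _ => Real.rpow_nonneg (by positivity) _

lemma gsNorm_ne_top_iff (M : WeightSequence) (m : ℝ) {d : ℕ} (f : (Fin d → ℝ) → ℂ) :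
    gsNorm M m f ≠ ⊤ ↔ ∃ C : ℝ, 0 ≤ C ∧ ∀ α β x, term M m f α β x ≤ C := by
  constructor
  · intro h
    refine ⟨(gsNorm M m f).toReal, ENNReal.toReal_nonneg, fun α β x => ?_⟩
    refine (ENNReal.ofReal_le_iff_le_toReal h).1 ?_
    exact le_iSup_of_le α (le_iSup_of_le β (le_iSup_of_le x le_rfl))
  · rintro ⟨C, _, hC⟩
    refine ne_top_of_le_ne_top (b := ENNReal.ofReal C) ENNReal.ofReal_ne_top ?_
    exact iSup_le fun α => iSup_le fun β => iSup_le fun x => ENNReal.ofReal_le_ofReal (hC α β x)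

lemma term_mono (M : WeightSequence) {m m' : ℝ} (hm : 0 ≤ m) (h : m ≤ m') {d : ℕ}
    (f : (Fin d → ℝ) → ℂ) (α β : Fin d → ℕ) (x : Fin d → ℝ) :
    term M m f α β x ≤ term M m' f α β x := by
  unfold term
  have h1 := M.seq_pos (len α)
  have h2 := M.seq_pos (len β)
  have h3 := wt_nonneg β x
  gcongr

lemma term_nonneg (M : WeightSequence) {m : ℝ} (hm : 0 ≤ m) {d : ℕ}
    (f : (Fin d → ℝ) → ℂ) (α β : Fin d → ℕ) (x : Fin d → ℝ) : 0 ≤ term M m f α β x := by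
  unfold term
  have h1 := M.seq_pos (len α)
  have h2 := M.seq_pos (len β)
  have h3 := wt_nonneg β x
  positivity

section derivatives

lemma pderiv_contDiff {d : ℕ} (i : Fin d) {f : (Fin d → ℝ) → ℂ} (hf : ContDiff ℝ ∞ f) :
    ContDiff ℝ ∞ (pderiv i f) := by
  have : pderiv i f = fun x => fderiv ℝ f x (Pi.single i 1) := by
    funext x
    exact ((hf.differentiable (by simp)) x).lineDeriv_eq_fderiv
  rw [this]
  exact (hf.fderiv_right (m := ∞) (by simp)).clm_apply contDiff_const

lemma pderiv_add {d : ℕ} (i : Fin d) {f g : (Fin d → ℝ) → ℂ} (hf : ContDiff ℝ ∞ f)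
    (hg : ContDiff ℝ ∞ g) : pderiv i (f + g) = pderiv i f + pderiv i g := by
  funext x
  have h1 := (hf.differentiable (by simp)) x
  have h2 := (hg.differentiable (by simp)) x
  simp [pderiv, h1.lineDeriv_eq_fderiv, h2.lineDeriv_eq_fderiv, (h1.add h2).lineDeriv_eq_fderiv,
    fderiv_add h1 h2]

lemma pderiv_smul {d : ℕ} (i : Fin d) (c : ℂ) {f : (Fin d → ℝ) → ℂ} (hf : ContDiff ℝ ∞ f) :
    pderiv i (c • f) = c • pderiv i f := by
  funext x
  have h1 := (hf.differentiable (by simp)) x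
  simp [pderiv, h1.lineDeriv_eq_fderiv, (h1.const_smul c).lineDeriv_eq_fderiv,
    fderiv_const_smul h1 c]

lemma iter_contDiff {d : ℕ} (i : Fin d) (n : ℕ) {f : (Fin d → ℝ) → ℂ} (hf : ContDiff ℝ ∞ f) :
    ContDiff ℝ ∞ ((pderiv i)^[n] f) := by
  induction n generalizing f with
  | zero => exact hf
  | succ n ih => exact ih (pderiv_contDiff i hf)

lemma iter_add {d : ℕ} (i : Fin d) (n : ℕ) {f g : (Fin d → ℝ) → ℂ} (hf : ContDiff ℝ ∞ f)
    (hg : ContDiff ℝ ∞ g) :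
    (pderiv i)^[n] (f + g) = (pderiv i)^[n] f + (pderiv i)^[n] g := by
  induction n generalizing f g with
  | zero => rfl
  | succ n ih =>
    simp only [Function.iterate_succ_apply]
    rw [pderiv_add i hf hg, ih (pderiv_contDiff i hf) (pderiv_contDiff i hg)]

lemma iter_smul {d : ℕ} (i : Fin d) (n : ℕ) (c : ℂ) {f : (Fin d → ℝ) → ℂ}
    (hf : ContDiff ℝ ∞ f) : (pderiv i)^[n] (c • f) = c • (pderiv i)^[n] f := by
  induction n generalizing f with
  | zero => rfl
  | succ n ih =>
    simp only [Function.iterate_succ_apply]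
    rw [pderiv_smul i c hf, ih (pderiv_contDiff i hf)]

lemma foldr_contDiff {d : ℕ} (α : Fin d → ℕ) (L : List (Fin d)) {f : (Fin d → ℝ) → ℂ}
    (hf : ContDiff ℝ ∞ f) :
    ContDiff ℝ ∞ (L.foldr (fun i g => (pderiv i)^[α i] g) f) := by
  induction L with
  | nil => exact hf
  | cons i L ih => exact iter_contDiff i (α i) ih

lemma mderiv_add {d : ℕ} (α : Fin d → ℕ) {f g : (Fin d → ℝ) → ℂ} (hf : ContDiff ℝ ∞ f)
    (hg : ContDiff ℝ ∞ g) : mderiv α (f + g) = mderiv α f + mderiv α g := by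
  unfold mderiv
  induction List.finRange d with
  | nil => rfl
  | cons i L ih =>
    simp only [List.foldr_cons]
    rw [ih, iter_add i _ (foldr_contDiff α L hf) (foldr_contDiff α L hg)]

lemma mderiv_smul {d : ℕ} (α : Fin d → ℕ) (c : ℂ) {f : (Fin d → ℝ) → ℂ}
    (hf : ContDiff ℝ ∞ f) : mderiv α (c • f) = c • mderiv α f := by
  unfold mderiv
  induction List.finRange d with
  | nil => rfl
  | cons i L ih =>
    simp only [List.foldr_cons]
    rw [ih, iter_smul i _ c (foldr_contDiff α L hf)]

end derivatives

lemma term_add_le (M : WeightSequence) {m : ℝ} (hm : 0 ≤ m) {d : ℕ} {f g : (Fin d → ℝ) → ℂ}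
    (hf : ContDiff ℝ ∞ f) (hg : ContDiff ℝ ∞ g) (α β : Fin d → ℕ) (x : Fin d → ℝ) :
    term M m (f + g) α β x ≤ term M m f α β x + term M m g α β x := by
  unfold term
  rw [mderiv_add α hf hg, ← mul_add, ← mul_add, Pi.add_apply]
  have h1 := M.seq_pos (len α)
  have h2 := M.seq_pos (len β)
  have h3 := wt_nonneg β x
  gcongr
  exact norm_add_le _ _

lemma term_smul (M : WeightSequence) (m : ℝ) {d : ℕ} (c : ℂ) {f : (Fin d → ℝ) → ℂ}
    (hf : ContDiff ℝ ∞ f) (α β : Fin d → ℕ) (x : Fin d → ℝ) :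
    term M m (c • f) α β x = ‖c‖ * term M m f α β x := by
  unfold term
  rw [mderiv_smul α c hf, Pi.smul_apply, norm_smul]
  ring

/-- The Gelfand-Shilov space of Roumieu type as a subspace of the space of all functions:
the smooth functions with `‖f‖_{S^{M_p}, m} < ∞` for some `m > 0`. -/
noncomputable def gsSubmodule (M : WeightSequence) (d : ℕ) : Submodule ℂ ((Fin d → ℝ) → ℂ) where
  carrier := {f | ContDiff ℝ ∞ f ∧ ∃ m : ℝ, 0 < m ∧ gsNorm M m f ≠ ⊤}
  zero_mem' := by
    refine ⟨contDiff_const, 1, one_pos, (gsNorm_ne_top_iff M 1 _).2 ⟨0, le_rfl, fun α β x => ?_⟩⟩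
    have h := term_smul M 1 (0 : ℂ) (f := (0 : (Fin d → ℝ) → ℂ)) contDiff_const α β x
    rw [zero_smul, norm_zero, zero_mul] at h
    exact h.le
  add_mem' := by
    rintro f g ⟨hf, m, hm, hfm⟩ ⟨hg, m', hm', hgm⟩
    obtain ⟨C, hC, h1⟩ := (gsNorm_ne_top_iff M m f).1 hfm
    obtain ⟨C', hC', h2⟩ := (gsNorm_ne_top_iff M m' g).1 hgm
    have hmin : 0 < min m m' := lt_min hm hm'
    refine ⟨hf.add hg, min m m', hmin,
      (gsNorm_ne_top_iff M _ _).2 ⟨C + C', add_nonneg hC hC', fun α β x => ?_⟩⟩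
    refine (term_add_le M hmin.le hf hg α β x).trans (add_le_add ?_ ?_)
    · exact (term_mono M hmin.le (min_le_left _ _) f α β x).trans (h1 α β x)
    · exact (term_mono M hmin.le (min_le_right _ _) g α β x).trans (h2 α β x)
  smul_mem' := by
    rintro c f ⟨hf, m, hm, hfm⟩
    obtain ⟨C, hC, h1⟩ := (gsNorm_ne_top_iff M m f).1 hfm
    refine ⟨contDiff_const.smul hf, m, hm,
      (gsNorm_ne_top_iff M _ _).2 ⟨‖c‖ * C, by positivity, fun α β x => ?_⟩⟩
    rw [term_smul M m c hf]
    exact mul_le_mul_of_nonneg_left (h1 α β x) (norm_nonneg c)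

/-- The Gelfand-Shilov space `S^{M_p}(ℝ^d)` of Roumieu type. It is a new type, so that it does not
carry the topology of pointwise convergence of the functions. -/
def Space (M : WeightSequence) (d : ℕ) : Type := ↥(gsSubmodule M d)

noncomputable instance (M : WeightSequence) (d : ℕ) : AddCommGroup (Space M d) :=
  inferInstanceAs (AddCommGroup ↥(gsSubmodule M d))

noncomputable instance (M : WeightSequence) (d : ℕ) : Module ℂ (Space M d) :=
  inferInstanceAs (Module ℂ ↥(gsSubmodule M d))

instance (M : WeightSequence) (d : ℕ) : CoeFun (Space M d) (fun _ => (Fin d → ℝ) → ℂ) :=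
  ⟨fun φ => φ.1⟩

/-- The seminorms on `S^{M_p}(ℝ^d)` whose restriction to each Banach space
`S^{M_p,m} = {φ | ‖φ‖_{S^{M_p}, m} < ∞}`, `m > 0`, is continuous. -/
def IsAdmissible {M : WeightSequence} {d : ℕ} (p : Seminorm ℂ (Space M d)) : Prop :=
  ∀ m : ℝ, 0 < m → ∃ C : ℝ, ∀ φ : Space M d, gsNorm M m φ ≠ ⊤ → p φ ≤ C * (gsNorm M m φ).toReal

/-- The family of all admissible seminorms. -/
def admissibleFamily (M : WeightSequence) (d : ℕ) :
    SeminormFamily ℂ (Space M d) {p : Seminorm ℂ (Space M d) // IsAdmissible p} :=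
  fun p => p.1

instance (M : WeightSequence) (d : ℕ) :
    Nonempty {p : Seminorm ℂ (Space M d) // IsAdmissible p} :=
  ⟨⟨0, fun _ _ => ⟨0, fun φ _ => by simp⟩⟩⟩

/-- The topology of the inductive limit of the Banach spaces `S^{M_p,m}`, `m > 0`, in the category
of locally convex spaces: the finest locally convex topology for which all the inclusions
`S^{M_p,m} → S^{M_p}(ℝ^d)` are continuous. It is generated by all admissible seminorms. -/
noncomputable instance (M : WeightSequence) (d : ℕ) : TopologicalSpace (Space M d) :=
  (admissibleFamily M d).moduleFilterBasis.topology

lemma withSeminorms (M : WeightSequence) (d : ℕ) : WithSeminorms (admissibleFamily M d) := ⟨rfl⟩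

instance (M : WeightSequence) (d : ℕ) : IsTopologicalAddGroup (Space M d) :=
  (withSeminorms M d).topologicalAddGroup

instance (M : WeightSequence) (d : ℕ) : ContinuousSMul ℂ (Space M d) :=
  (withSeminorms M d).continuousSMul

/-- The dual `S^{M_p}'(ℝ^d)`: the continuous linear functionals, with the strong topology, that of
uniform convergence on the bounded subsets of `S^{M_p}(ℝ^d)`. -/
abbrev Dual (M : WeightSequence) (d : ℕ) : Type := Space M d →L[ℂ] ℂ

section tensor

/-- The tensor product `(ψ ⊗ φ)(x, y) = ψ(x) φ(y)` of functions. -/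
def tensorFun {l s : ℕ} (f : (Fin l → ℝ) → ℂ) (g : (Fin s → ℝ) → ℂ) : (Fin (l + s) → ℝ) → ℂ :=
  fun z => f (fun i => z (Fin.castAdd s i)) * g (fun j => z (Fin.natAdd l j))

lemma pderiv_tensor_left {l s : ℕ} (i : Fin l) (f : (Fin l → ℝ) → ℂ) (g : (Fin s → ℝ) → ℂ) :
    pderiv (Fin.castAdd s i) (tensorFun f g) = tensorFun (pderiv i f) g := by
  funext z
  unfold pderiv tensorFun lineDeriv
  rw [← deriv_mul_const_field]
  congr 1
  funext t
  dsimp only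
  congr 2
  · funext k
    simp [Pi.single_apply]
  · funext k
    have : Fin.natAdd l k ≠ Fin.castAdd s i := fun h => by
      have := congrArg Fin.val h
      simp at this
      omega
    simp [Pi.single_apply, this]

lemma pderiv_tensor_right {l s : ℕ} (j : Fin s) (f : (Fin l → ℝ) → ℂ) (g : (Fin s → ℝ) → ℂ) :
    pderiv (Fin.natAdd l j) (tensorFun f g) = tensorFun f (pderiv j g) := by
  funext z
  unfold pderiv tensorFun lineDeriv
  rw [← deriv_const_mul_field]
  congr 1
  funext t
  dsimp only
  congr 2
  · funext k
    have : Fin.castAdd s k ≠ Fin.natAdd l j := fun h => by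
      have := congrArg Fin.val h
      simp at this
      omega
    simp [Pi.single_apply, this]
  · funext k
    simp [Pi.single_apply]

lemma mderiv_tensor {l s : ℕ} (α : Fin (l + s) → ℕ) (f : (Fin l → ℝ) → ℂ)
    (g : (Fin s → ℝ) → ℂ) :
    mderiv α (tensorFun f g) =
      tensorFun (mderiv (fun i => α (Fin.castAdd s i)) f)
        (mderiv (fun j => α (Fin.natAdd l j)) g) := by
  have hl : ∀ (i : Fin l) (n : ℕ) (f : (Fin l → ℝ) → ℂ) (g : (Fin s → ℝ) → ℂ),
      (pderiv (Fin.castAdd s i))^[n] (tensorFun f g) = tensorFun ((pderiv i)^[n] f) g := by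
    intro i n
    induction n with
    | zero => intro f g; rfl
    | succ n ih =>
      intro f g
      simp only [Function.iterate_succ_apply]
      rw [pderiv_tensor_left, ih]
  have hr : ∀ (j : Fin s) (n : ℕ) (f : (Fin l → ℝ) → ℂ) (g : (Fin s → ℝ) → ℂ),
      (pderiv (Fin.natAdd l j))^[n] (tensorFun f g) = tensorFun f ((pderiv j)^[n] g) := by
    intro j n
    induction n with
    | zero => intro f g; rfl
    | succ n ih =>
      intro f g
      simp only [Function.iterate_succ_apply]
      rw [pderiv_tensor_right, ih]
  have hsplit : List.finRange (l + s) =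
      (List.finRange l).map (Fin.castAdd s) ++ (List.finRange s).map (Fin.natAdd l) := by
    rw [← List.ofFn_id, List.ofFn_add, ← List.ofFn_id, ← List.ofFn_id, List.map_ofFn,
      List.map_ofFn]
    rfl
  unfold mderiv
  rw [hsplit, List.foldr_append, List.foldr_map, List.foldr_map]
  have h2 : ∀ L : List (Fin s),
      L.foldr (fun j g => (pderiv (Fin.natAdd l j))^[α (Fin.natAdd l j)] g) (tensorFun f g) =
      tensorFun f (L.foldr (fun j g => (pderiv j)^[α (Fin.natAdd l j)] g) g) := by
    intro L
    induction L with
    | nil => rfl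
    | cons j L ih => simp only [List.foldr_cons, ih, hr]
  rw [h2]
  generalize List.foldr (fun j g => (pderiv j)^[α (Fin.natAdd l j)] g) g (List.finRange s) = g'
  induction List.finRange l with
  | nil => rfl
  | cons i L ih => simp only [List.foldr_cons, ih, hl]

lemma seq_mul_le (M : WeightSequence) (p q : ℕ) : M.seq p * M.seq q ≤ M.seq (p + q) := by
  have hratio : ∀ p q, M.seq (p + 1) * M.seq q ≤ M.seq p * M.seq (q + 1) ∨ q < p := by
    intro p q
    rcases lt_or_ge q p with h | h
    · exact Or.inr h
    · left
      induction q, h using Nat.le_induction with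
      | base => exact le_of_eq (mul_comm _ _)
      | succ q hq ih =>
        have h1 := M.log_convex (q + 1) (by omega)
        simp only [Nat.add_sub_cancel] at h1
        have a := M.seq_pos p
        have b := M.seq_pos q
        have c := M.seq_pos (q + 1)
        have e := M.seq_pos (q + 1 + 1)
        have f := M.seq_pos (p + 1)
        refine le_of_mul_le_mul_right ?_ b
        calc M.seq (p + 1) * M.seq (q + 1) * M.seq q
            = (M.seq (p + 1) * M.seq q) * M.seq (q + 1) := by ring
          _ ≤ (M.seq p * M.seq (q + 1)) * M.seq (q + 1) := by gcongr
          _ = M.seq p * M.seq (q + 1) ^ 2 := by ring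
          _ ≤ M.seq p * (M.seq q * M.seq (q + 1 + 1)) := by gcongr
          _ = M.seq p * M.seq (q + 1 + 1) * M.seq q := by ring
  induction p with
  | zero => simp [M.seq_zero]
  | succ p ih =>
    have h := (hratio p (p + q)).resolve_right (by omega)
    have a := M.seq_pos p
    have b := M.seq_pos (p + 1)
    refine le_of_mul_le_mul_left ?_ a
    calc M.seq p * (M.seq (p + 1) * M.seq q)
        = M.seq (p + 1) * (M.seq p * M.seq q) := by ring
      _ ≤ M.seq (p + 1) * M.seq (p + q) := by gcongr
      _ ≤ M.seq p * M.seq (p + q + 1) := h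
      _ = M.seq p * M.seq (p + 1 + q) := by rw [Nat.add_right_comm]

lemma term_tensor_le (M : WeightSequence) {m : ℝ} (hm : 0 ≤ m) {l s : ℕ}
    (f : (Fin l → ℝ) → ℂ) (g : (Fin s → ℝ) → ℂ) (α β : Fin (l + s) → ℕ)
    (z : Fin (l + s) → ℝ) :
    term M m (tensorFun f g) α β z ≤
      term M m f (fun i => α (Fin.castAdd s i)) (fun i => β (Fin.castAdd s i))
          (fun i => z (Fin.castAdd s i)) *
        term M m g (fun j => α (Fin.natAdd l j)) (fun j => β (Fin.natAdd l j))
          (fun j => z (Fin.natAdd l j)) := by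
  have hlen : ∀ γ : Fin (l + s) → ℕ, len γ =
      len (fun i => γ (Fin.castAdd s i)) + len (fun j => γ (Fin.natAdd l j)) :=
    fun γ => Fin.sum_univ_add _
  have hwt : wt β z = wt (fun i => β (Fin.castAdd s i)) (fun i => z (Fin.castAdd s i)) *
      wt (fun j => β (Fin.natAdd l j)) (fun j => z (Fin.natAdd l j)) :=
    Fin.prod_univ_add _
  unfold term
  rw [mderiv_tensor, hlen α, hlen β, hwt]
  simp only [tensorFun, norm_mul]
  generalize len (fun i => α (Fin.castAdd s i)) = a1
  generalize len (fun j => α (Fin.natAdd l j)) = a2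
  generalize len (fun i => β (Fin.castAdd s i)) = b1
  generalize len (fun j => β (Fin.natAdd l j)) = b2
  have w1 := wt_nonneg (fun i => β (Fin.castAdd s i)) (fun i => z (Fin.castAdd s i))
  have w2 := wt_nonneg (fun j => β (Fin.natAdd l j)) (fun j => z (Fin.natAdd l j))
  generalize wt (fun i => β (Fin.castAdd s i)) (fun i => z (Fin.castAdd s i)) = u1 at w1 ⊢
  generalize wt (fun j => β (Fin.natAdd l j)) (fun j => z (Fin.natAdd l j)) = u2 at w2 ⊢
  have n1 := norm_nonneg (mderiv (fun i => α (Fin.castAdd s i)) f fun i => z (Fin.castAdd s i))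
  have n2 := norm_nonneg (mderiv (fun j => α (Fin.natAdd l j)) g fun j => z (Fin.natAdd l j))
  generalize ‖mderiv (fun i => α (Fin.castAdd s i)) f fun i => z (Fin.castAdd s i)‖ = v1 at n1 ⊢
  generalize ‖mderiv (fun j => α (Fin.natAdd l j)) g fun j => z (Fin.natAdd l j)‖ = v2 at n2 ⊢
  have p1 := M.seq_pos a1
  have p2 := M.seq_pos a2
  have p3 := M.seq_pos b1
  have p4 := M.seq_pos b2
  have hM : (M.seq a1 * M.seq a2) * (M.seq b1 * M.seq b2) ≤
      M.seq (a1 + a2) * M.seq (b1 + b2) :=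
    mul_le_mul (seq_mul_le M a1 a2) (seq_mul_le M b1 b2) (by positivity) (M.seq_pos _).le
  calc m ^ (a1 + a2 + (b1 + b2)) / (M.seq (a1 + a2) * M.seq (b1 + b2)) *
        (u1 * u2 * (v1 * v2))
      ≤ m ^ (a1 + a2 + (b1 + b2)) / ((M.seq a1 * M.seq a2) * (M.seq b1 * M.seq b2)) *
        (u1 * u2 * (v1 * v2)) := by gcongr
    _ = _ := by
      rw [show a1 + a2 + (b1 + b2) = (a1 + b1) + (a2 + b2) by ring, pow_add]
      field_simp

/-- The tensor product `ψ ⊗ φ ∈ S^{M_p}(ℝ^{l+s})` of `ψ ∈ S^{M_p}(ℝ^l)` and `φ ∈ S^{M_p}(ℝ^s)`,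
`(ψ ⊗ φ)(x, y) = ψ(x) φ(y)`. -/
def tensor {M : WeightSequence} {l s : ℕ} (ψ : Space M l) (φ : Space M s) : Space M (l + s) :=
  ⟨tensorFun ψ φ, by
    obtain ⟨f, hf, m, hm, hfm⟩ := ψ
    obtain ⟨g, hg, m', hm', hgm⟩ := φ
    obtain ⟨C, hC, h1⟩ := (gsNorm_ne_top_iff M m f).1 hfm
    obtain ⟨C', hC', h2⟩ := (gsNorm_ne_top_iff M m' g).1 hgm
    have hmin : 0 < min m m' := lt_min hm hm'
    refine ⟨?_, min m m', hmin,
      (gsNorm_ne_top_iff M _ _).2 ⟨C * C', mul_nonneg hC hC', fun α β x => ?_⟩⟩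
    · exact (hf.comp (contDiff_pi.2 fun i => contDiff_apply ℝ ℝ (Fin.castAdd s i))).mul
        (hg.comp (contDiff_pi.2 fun j => contDiff_apply ℝ ℝ (Fin.natAdd l j)))
    · refine (term_tensor_le M hmin.le f g α β x).trans (mul_le_mul ?_ ?_ ?_ hC)
      · exact (term_mono M hmin.le (min_le_left _ _) f _ _ _).trans (h1 _ _ _)
      · exact (term_mono M hmin.le (min_le_right _ _) g _ _ _).trans (h2 _ _ _)
      · exact term_nonneg M hmin.le g _ _ _⟩

end tensor

end GelfandShilov

/-!
The proof expands everything in Hermite functions. Write `h_n`, `n ∈ ℕ^d`, for the normalized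
Hermite functions and `a_n(f) = ∫ f h_n`. The core is that for `f ∈ S^{M_p,m}` the series
`∑ a_n(f) h_n` converges absolutely in `S^{M_p,m'}` for some `m' > 0` that depends on `m` only
(`exists_normLE_coeff_smul`). Two estimates, both obtained from the ladder operators, are played
against each other.

* Growth: `x_i` and `∂_i` map `h_n` to combinations of neighbouring Hermite functions with
  coefficients of size `√|n|`, so that a weighted derivative of `h_n` of total order `p` is
  bounded by `(|n| + p)^{p/2}`, up to a factor exponential in `p` and one polynomial in `|n| + p`
  (`wt_mul_norm_mderiv_hermiteFun_le`).
* Decay: integration by parts moves the raising operators from `h_n` to `f`, where they become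
  powers of `x_i + ∂_i`. By (M.1) and (M.3)'' one has `p M_{p-1} ≲ M_{p+1}`, which absorbs the
  commutators, and `(x_i + ∂_i)^k f` is bounded by `D^k M_k`. Hence
  `|a_n(f)| ≲ D^k M_k n_i^{-k/2}`, up to a polynomial factor, for every `k ≤ n_i / 2`
  (`exists_norm_coeff_mul_sqrt_pow_le`).

If `p` is small compared with the largest index `n_i`, one takes `k = p + 8d`, and (M.2) separates
`M_{p+8d}` from `M_p`; if `p` is large, then `(|n| + p)^{p/2}` is comparable with `p^{p/2}`, which
is bounded by `M_p` thanks to (M.3)''.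

The sum of the series is `f`: a bounded continuous function orthogonal to all Hermite functions is
zero, because the Fourier transform of its product with a Gaussian vanishes
(`eq_zero_of_coeff_eq_zero`). With termwise differentiation it follows that the Hermite expansion
converges in the inductive limit (`hasSum_coeff_smul_hermiteSpace`).

Now let `T` be sequentially continuous. The unit balls of the spaces `S^{M_p,m}` are bounded and
null sequences of `S^{M_p,m}` are null sequences of the inductive limit, so `(ψ, φ) ↦ ⟨Tφ, ψ⟩` is
bounded on `S^{M_p,m} × S^{M_p,m}` for each `m` (`bounded_of_seqContinuous`). By (M.2) the norm of
`ψ ⊗ φ` dominates the product of the norms of `ψ` and `φ`, after a change of `m`, and the Hermite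
functions on `ℝ^{l+s}` are the tensor products `h_{n'} ⊗ h_{n''}`. Therefore
`K(f) = ∑ a_{(n', n'')}(f) ⟨T h_{n''}, h_{n'}⟩` converges absolutely and defines a functional
that is bounded on each `S^{M_p,m}`, that is, a continuous one. It is the kernel of `T`, and the only
one, because the Hermite functions span a dense subspace.

The first part of the theorem is soft: a jointly continuous bilinear functional is hypocontinuous.
-/

namespace GelfandShilov

/-! ### Functionals on the inductive limit -/

/-- `‖f‖_{S^{M_p}, m} ≤ Q`, phrased with real numbers. -/
def NormLE (M : WeightSequence) (m Q : ℝ) {d : ℕ} (f : (Fin d → ℝ) → ℂ) : Prop :=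
  ∀ α β x, term M m f α β x ≤ Q

section NormLE

variable {M : WeightSequence} {m Q : ℝ} {d : ℕ} {f g : (Fin d → ℝ) → ℂ}

lemma mderiv_zero (f : (Fin d → ℝ) → ℂ) : mderiv 0 f = f := by
  unfold mderiv
  induction List.finRange d with
  | nil => rfl
  | cons i L ih => simp [List.foldr_cons]

lemma term_zero_zero (M : WeightSequence) (m : ℝ) (f : (Fin d → ℝ) → ℂ) (x : Fin d → ℝ) :
    term M m f 0 0 x = ‖f x‖ := by
  simp [term, mderiv_zero, len, wt, M.seq_zero]

lemma NormLE.norm_le (h : NormLE M m Q f) (x : Fin d → ℝ) : ‖f x‖ ≤ Q :=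
  term_zero_zero M m f x ▸ h 0 0 x

lemma NormLE.nonneg (h : NormLE M m Q f) : 0 ≤ Q := (norm_nonneg _).trans (h.norm_le 0)

lemma NormLE.mono {Q' : ℝ} (h : NormLE M m Q f) (hQ : Q ≤ Q') : NormLE M m Q' f :=
  fun α β x => (h α β x).trans hQ

lemma NormLE.mono_index {m' : ℝ} (h : NormLE M m Q f) (hm : 0 ≤ m') (hmm : m' ≤ m) :
    NormLE M m' Q f :=
  fun α β x => (term_mono M hm hmm f α β x).trans (h α β x)

lemma NormLE.smul (h : NormLE M m Q f) (hf : ContDiff ℝ ∞ f) (c : ℂ) :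
    NormLE M m (‖c‖ * Q) (c • f) := fun α β x => by
  rw [term_smul M m c hf]
  exact mul_le_mul_of_nonneg_left (h α β x) (norm_nonneg c)

lemma NormLE.ne_top (h : NormLE M m Q f) : gsNorm M m f ≠ ⊤ :=
  (gsNorm_ne_top_iff M m f).2 ⟨Q, h.nonneg, h⟩

lemma NormLE.toReal_le (h : NormLE M m Q f) : (gsNorm M m f).toReal ≤ Q :=
  ENNReal.toReal_le_of_le_ofReal h.nonneg
    (iSup_le fun α => iSup_le fun β => iSup_le fun x => ENNReal.ofReal_le_ofReal (h α β x))

lemma normLE_toReal (h : gsNorm M m f ≠ ⊤) : NormLE M m (gsNorm M m f).toReal f :=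
  fun α β x => (ENNReal.ofReal_le_iff_le_toReal h).1
    (le_iSup_of_le α (le_iSup_of_le β (le_iSup_of_le x le_rfl)))

end NormLE

section functionals

variable {M : WeightSequence} {d : ℕ}

lemma Space.contDiff (φ : Space M d) : ContDiff ℝ ∞ (φ : (Fin d → ℝ) → ℂ) := φ.2.1

lemma Space.ext {φ ψ : Space M d} (h : ∀ x, φ x = ψ x) : φ = ψ := Subtype.ext (funext h)

lemma Space.exists_normLE (φ : Space M d) : ∃ m Q : ℝ, 0 < m ∧ NormLE M m Q φ :=
  let ⟨m, hm, h⟩ := φ.2.2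
  ⟨m, _, hm, normLE_toReal h⟩

lemma Space.coe_smul (c : ℂ) (φ : Space M d) :
    ((c • φ : Space M d) : (Fin d → ℝ) → ℂ) = c • (φ : (Fin d → ℝ) → ℂ) := rfl

lemma Space.coe_sub (φ ψ : Space M d) :
    ((φ - ψ : Space M d) : (Fin d → ℝ) → ℂ) = (φ : (Fin d → ℝ) → ℂ) - ψ := rfl

lemma Space.coe_sum {ι : Type*} (s : Finset ι) (u : ι → Space M d) (x : Fin d → ℝ) :
    (∑ i ∈ s, u i : Space M d) x = ∑ i ∈ s, u i x := by
  have : (∑ i ∈ s, u i : Space M d).1 = ∑ i ∈ s, (u i).1 :=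
    map_sum (gsSubmodule M d).subtype _ _
  rw [this, Finset.sum_apply]

lemma isAdmissible_iff (p : Seminorm ℂ (Space M d)) :
    IsAdmissible p ↔ ∀ m : ℝ, 0 < m → ∃ C : ℝ, 0 ≤ C ∧
      ∀ (φ : Space M d) (Q : ℝ), NormLE M m Q φ → p φ ≤ C * Q := by
  refine forall₂_congr fun m hm => ⟨?_, ?_⟩
  · rintro ⟨C, hC⟩
    refine ⟨max C 0, le_max_right _ _, fun φ Q h => (hC φ h.ne_top).trans ?_⟩
    gcongr
    · exact le_max_left _ _
    · exact h.toReal_le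
  · rintro ⟨C, -, hC⟩
    exact ⟨C, fun φ h => hC φ _ (normLE_toReal h)⟩

/-- A linear functional that is bounded on each Banach space `S^{M_p,m}` is continuous. -/
lemma continuous_of_bounded (K : Space M d →ₗ[ℂ] ℂ)
    (hK : ∀ m : ℝ, 0 < m → ∃ C : ℝ, 0 ≤ C ∧
      ∀ (φ : Space M d) (Q : ℝ), NormLE M m Q φ → ‖K φ‖ ≤ C * Q) : Continuous K := by
  have hp : IsAdmissible ((normSeminorm ℂ ℂ).comp K) := (isAdmissible_iff _).2 hK
  refine WithSeminorms.continuous_normedSpace_rng ℂ (withSeminorms M d) K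
    ⟨{⟨_, hp⟩}, 1, ?_⟩
  rw [Finset.sup_singleton, one_smul]
  exact le_rfl

lemma bounded_of_continuous (K : Dual M d) {m : ℝ} (hm : 0 < m) : ∃ C : ℝ, 0 ≤ C ∧
    ∀ (φ : Space M d) (Q : ℝ), NormLE M m Q φ → ‖K φ‖ ≤ C * Q := by
  obtain ⟨s, C, -, hC⟩ := Seminorm.bound_of_continuous (withSeminorms M d)
    ((normSeminorm ℂ ℂ).comp K.toLinearMap) (by
      change Continuous fun φ => ‖K φ‖
      exact K.continuous.norm)
  have hs : ∀ s : Finset {p : Seminorm ℂ (Space M d) // IsAdmissible p},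
      ∃ C : ℝ, 0 ≤ C ∧ ∀ (φ : Space M d) (Q : ℝ), NormLE M m Q φ →
        s.sup (admissibleFamily M d) φ ≤ C * Q := by
    intro s
    classical
    induction s using Finset.induction_on with
    | empty => exact ⟨0, le_rfl, fun φ Q _ => by simp⟩
    | insert p s _ ih =>
      obtain ⟨C₁, h₁, hC₁⟩ := ih
      obtain ⟨C₂, h₂, hC₂⟩ := (isAdmissible_iff p.1).1 p.2 m hm
      refine ⟨max C₂ C₁, le_max_of_le_left h₂, fun φ Q h => ?_⟩
      rw [Finset.sup_insert, Seminorm.sup_apply]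
      refine sup_le ((hC₂ φ Q h).trans ?_) ((hC₁ φ Q h).trans ?_)
      · exact mul_le_mul_of_nonneg_right (le_max_left _ _) h.nonneg
      · exact mul_le_mul_of_nonneg_right (le_max_right _ _) h.nonneg
  obtain ⟨D, hD, h⟩ := hs s
  refine ⟨C * D, by positivity, fun φ Q hQ => (hC φ).trans ?_⟩
  rw [mul_assoc]
  exact mul_le_mul_of_nonneg_left (h φ Q hQ) C.2

/-- Convergence to zero in one of the Banach spaces `S^{M_p,m}` implies convergence in the
inductive limit. -/
lemma tendsto_of_normLE {ι : Type*} {F : Filter ι} {u : ι → Space M d} {φ : Space M d} {m : ℝ}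
    (hm : 0 < m) {Q : ι → ℝ} (hQ : Tendsto Q F (𝓝 0))
    (h : ∀ i, NormLE M m (Q i) (u i - φ : Space M d)) :
    Tendsto u F (𝓝 φ) := by
  rw [(withSeminorms M d).tendsto_nhds u φ]
  rintro p ε hε
  obtain ⟨C, -, hC⟩ := (isAdmissible_iff p.1).1 p.2 m hm
  have : Tendsto (fun i => C * Q i) F (𝓝 0) := by simpa using hQ.const_mul C
  filter_upwards [this.eventually (gt_mem_nhds hε)] with i hi
  exact (hC _ _ (h i)).trans_lt hi

/-- The unit ball of each Banach space `S^{M_p,m}` is bounded in the inductive limit. -/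
lemma isVonNBounded_ball (M : WeightSequence) (d : ℕ) {m : ℝ} (hm : 0 < m) :
    Bornology.IsVonNBounded ℂ {φ : Space M d | NormLE M m 1 φ} := by
  rw [(withSeminorms M d).isVonNBounded_iff_seminorm_bounded]
  intro p
  obtain ⟨C, hC0, hC⟩ := (isAdmissible_iff p.1).1 p.2 m hm
  exact ⟨C + 1, by positivity, fun φ hφ => (hC φ 1 hφ).trans_lt (by linarith)⟩

end functionals

section bilinear

variable {M : WeightSequence} {l s : ℕ}

/-- A sequentially continuous map into the strong dual gives a bilinear functional that is bounded
on the product of the Banach spaces of each index `m`. -/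
lemma bounded_of_seqContinuous (T : Space M s →ₗ[ℂ] Dual M l)
    (hT : ∀ u : ℕ → Space M s, Tendsto u atTop (𝓝 0) → Tendsto (fun j => T (u j)) atTop (𝓝 0))
    {m : ℝ} (hm : 0 < m) :
    ∃ C : ℝ, 0 ≤ C ∧ ∀ (φ : Space M s) (ψ : Space M l) (Q R : ℝ),
      NormLE M m Q φ → NormLE M m R ψ → ‖T φ ψ‖ ≤ C * Q * R := by
  have key : ∃ C : ℝ, 0 ≤ C ∧ ∀ (φ : Space M s) (ψ : Space M l),
      NormLE M m 1 φ → NormLE M m 1 ψ → ‖T φ ψ‖ ≤ C := by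
    by_contra! hcon
    choose φ ψ hφ hψ hlt using fun n : ℕ => hcon ((n : ℝ) + 1) (by positivity)
    have hnorm : ∀ n : ℕ, ‖((n : ℂ) + 1)⁻¹‖ = ((n : ℝ) + 1)⁻¹ := fun n => by
      rw [norm_inv]
      norm_cast
    have h0 : Tendsto (fun n : ℕ => ((n : ℂ) + 1)⁻¹ • φ n) atTop (𝓝 0) := by
      refine tendsto_of_normLE (Q := fun n : ℕ => ((n : ℝ) + 1)⁻¹) hm ?_ fun n => ?_
      · simpa using tendsto_one_div_add_atTop_nhds_zero_nat (𝕜 := ℝ)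
      · rw [sub_zero]
        have := (hφ n).smul (φ n).contDiff ((n : ℂ) + 1)⁻¹
        rwa [hnorm, mul_one] at this
    have h1 := (hT _ h0).eventually (ContinuousLinearMap.eventually_nhds_zero_mapsTo
      (isVonNBounded_ball M l hm) (Metric.ball_mem_nhds (0 : ℂ) one_pos))
    obtain ⟨n, hn⟩ := h1.exists
    have h2 := hn (hψ n)
    rw [map_smul, mem_ball_zero_iff, smul_apply, norm_smul, hnorm] at h2
    have h3 : (0 : ℝ) < (n : ℝ) + 1 := by positivity
    rw [inv_mul_lt_iff₀ h3, mul_one] at h2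
    exact lt_asymm h2 (hlt n)
  obtain ⟨C, hC0, hC⟩ := key
  refine ⟨C, hC0, fun φ ψ Q R hφ hψ => ?_⟩
  rcases hφ.nonneg.eq_or_lt with rfl | hQ
  · have : φ = 0 := Space.ext fun x => norm_le_zero_iff.1 (hφ.norm_le x)
    simp [this]
  rcases hψ.nonneg.eq_or_lt with rfl | hR
  · have : ψ = 0 := Space.ext fun x => norm_le_zero_iff.1 (hψ.norm_le x)
    simp [this]
  have hn : ∀ r : ℝ, 0 < r → ‖((r : ℂ))⁻¹‖ = r⁻¹ := fun r hr => by
    rw [norm_inv, Complex.norm_real, Real.norm_of_nonneg hr.le]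
  have h1 := hC ((Q : ℂ)⁻¹ • φ) ((R : ℂ)⁻¹ • ψ)
    ((hφ.smul φ.contDiff _).mono (by rw [hn Q hQ, inv_mul_cancel₀ hQ.ne']))
    ((hψ.smul ψ.contDiff _).mono (by rw [hn R hR, inv_mul_cancel₀ hR.ne']))
  rw [map_smul, map_smul, smul_apply, norm_smul, norm_smul, hn Q hQ,
    hn R hR, inv_mul_le_iff₀ hR, inv_mul_le_iff₀ hQ] at h1
  linarith

/-- Up to a change of the index `m`, made possible by (M.2), the norm of a tensor product
dominates the product of the norms of its factors. -/
lemma exists_term_mul_term_le (M : WeightSequence) : ∃ A H : ℝ, 0 < A ∧ 0 < H ∧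
    ∀ {l s : ℕ} (f : (Fin l → ℝ) → ℂ) (g : (Fin s → ℝ) → ℂ) (m : ℝ), 0 < m →
      ∀ α β x α' β' x', term M m f α β x * term M m g α' β' x' ≤
        A * term M (H * m) (tensorFun f g) (Fin.append α α') (Fin.append β β')
          (Fin.append x x') := by
  obtain ⟨A, H, hA, hH, hAH⟩ := M.stable
  refine ⟨A ^ 2, H, by positivity, hH, ?_⟩
  intro l s f g m hm α β x α' β' x'
  have hlen : ∀ (a : Fin l → ℕ) (b : Fin s → ℕ), len (Fin.append a b) = len a + len b :=
    fun a b => by simp [len, Fin.sum_univ_add]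
  have hwt : wt (Fin.append β β') (Fin.append x x') = wt β x * wt β' x' := by
    simp [wt, Fin.prod_univ_add]
  unfold term
  rw [mderiv_tensor, hlen, hlen, hwt]
  simp only [tensorFun, norm_mul, Fin.append_left, Fin.append_right]
  have hst : ∀ a b : ℕ, M.seq (a + b) ≤ A * H ^ (a + b) * (M.seq a * M.seq b) := fun a b => by
    simpa using hAH (a + b) a (by omega)
  have ha := hst (len α) (len α')
  have hb := hst (len β) (len β')
  generalize len α = a1 at *
  generalize len α' = a2 at *
  generalize len β = b1 at *
  generalize len β' = b2 at *
  have p1 := M.seq_pos a1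
  have p2 := M.seq_pos a2
  have p3 := M.seq_pos b1
  have p4 := M.seq_pos b2
  have p5 := M.seq_pos (a1 + a2)
  have p6 := M.seq_pos (b1 + b2)
  have hW : 0 ≤ wt β x * wt β' x' *
      (‖mderiv (fun i => α i) f fun i => x i‖ * ‖mderiv (fun i => α' i) g fun i => x' i‖) :=
    mul_nonneg (mul_nonneg (wt_nonneg _ _) (wt_nonneg _ _)) (by positivity)
  have hM : M.seq (a1 + a2) * M.seq (b1 + b2) ≤
      A ^ 2 * H ^ (a1 + a2 + (b1 + b2)) * (M.seq a1 * M.seq b1 * (M.seq a2 * M.seq b2)) := by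
    calc M.seq (a1 + a2) * M.seq (b1 + b2)
        ≤ (A * H ^ (a1 + a2) * (M.seq a1 * M.seq a2)) *
          (A * H ^ (b1 + b2) * (M.seq b1 * M.seq b2)) := by gcongr
      _ = _ := by rw [pow_add H (a1 + a2)]; ring
  have hq : m ^ (a1 + b1) / (M.seq a1 * M.seq b1) * (m ^ (a2 + b2) / (M.seq a2 * M.seq b2)) ≤
      A ^ 2 * ((H * m) ^ (a1 + a2 + (b1 + b2)) / (M.seq (a1 + a2) * M.seq (b1 + b2))) := by
    rw [div_mul_div_comm, ← mul_div_assoc, div_le_div_iff₀ (by positivity) (by positivity)]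
    calc m ^ (a1 + b1) * m ^ (a2 + b2) * (M.seq (a1 + a2) * M.seq (b1 + b2))
        ≤ m ^ (a1 + b1) * m ^ (a2 + b2) * (A ^ 2 * H ^ (a1 + a2 + (b1 + b2)) *
          (M.seq a1 * M.seq b1 * (M.seq a2 * M.seq b2))) := by gcongr
      _ = _ := by rw [mul_pow]; ring
  calc _ = m ^ (a1 + b1) / (M.seq a1 * M.seq b1) * (m ^ (a2 + b2) / (M.seq a2 * M.seq b2)) *
        (wt β x * wt β' x' * (‖mderiv (fun i => α i) f fun i => x i‖ *
          ‖mderiv (fun i => α' i) g fun i => x' i‖)) := by ring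
    _ ≤ A ^ 2 * ((H * m) ^ (a1 + a2 + (b1 + b2)) / (M.seq (a1 + a2) * M.seq (b1 + b2))) *
        (wt β x * wt β' x' * (‖mderiv (fun i => α i) f fun i => x i‖ *
          ‖mderiv (fun i => α' i) g fun i => x' i‖)) := mul_le_mul_of_nonneg_right hq hW
    _ = _ := by ring

/-- A bilinear functional bounded on the products of the Banach spaces of each index is bounded by
the norms of the tensor products. -/
lemma bounded_by_tensor (T : Space M s →ₗ[ℂ] Dual M l)
    (hT : ∀ m : ℝ, 0 < m → ∃ C : ℝ, 0 ≤ C ∧ ∀ (φ : Space M s) (ψ : Space M l) (Q R : ℝ),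
      NormLE M m Q φ → NormLE M m R ψ → ‖T φ ψ‖ ≤ C * Q * R) {m : ℝ} (hm : 0 < m) :
    ∃ C : ℝ, 0 ≤ C ∧ ∀ (φ : Space M s) (ψ : Space M l) (Q : ℝ),
      NormLE M m Q (tensor ψ φ) → ‖T φ ψ‖ ≤ C * Q := by
  obtain ⟨A, H, hA, hH, hAH⟩ := exists_term_mul_term_le M
  obtain ⟨C, hC0, hC⟩ := hT (m / H) (by positivity)
  refine ⟨C * A, by positivity, fun φ ψ Q hQ => ?_⟩
  have hmul : ∀ α β x α' β' x',
      term M (m / H) ψ α β x * term M (m / H) φ α' β' x' ≤ A * Q := by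
    intro α β x α' β' x'
    refine (hAH ψ φ (m / H) (by positivity) α β x α' β' x').trans ?_
    rw [mul_div_cancel₀ _ hH.ne']
    exact mul_le_mul_of_nonneg_left (hQ _ _ _) hA.le
  have hm' : 0 ≤ m / H := by positivity
  by_cases hφ : φ = 0
  · simpa [hφ] using mul_nonneg (mul_nonneg hC0 hA.le) hQ.nonneg
  by_cases hψ : ψ = 0
  · simpa [hψ] using mul_nonneg (mul_nonneg hC0 hA.le) hQ.nonneg
  obtain ⟨y, hy⟩ : ∃ y, φ y ≠ 0 := by
    by_contra! h
    exact hφ (Space.ext h)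
  obtain ⟨z, hz⟩ : ∃ z, ψ z ≠ 0 := by
    by_contra! h
    exact hψ (Space.ext h)
  have hψ1 : ∀ α' β' x', 0 < term M (m / H) φ α' β' x' →
      NormLE M (m / H) (A * Q / term M (m / H) φ α' β' x') ψ := fun α' β' x' hpos α β x => by
    rw [le_div_iff₀ hpos]
    exact hmul α β x α' β' x'
  set R := (gsNorm M (m / H) ψ).toReal with hR
  have hψR : NormLE M (m / H) R ψ := normLE_toReal
    (hψ1 0 0 y (by rw [term_zero_zero]; exact norm_pos_iff.2 hy)).ne_top
  have hRpos : 0 < R := (norm_pos_iff.2 hz).trans_le (hψR.norm_le z)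
  have hφR : NormLE M (m / H) (A * Q / R) φ := by
    intro α' β' x'
    rw [le_div_iff₀ hRpos]
    rcases (term_nonneg M hm' φ α' β' x').eq_or_lt with h0 | hpos
    · rw [← h0, zero_mul]
      exact mul_nonneg hA.le hQ.nonneg
    · rw [mul_comm, ← le_div_iff₀ hpos]
      exact (hψ1 α' β' x' hpos).toReal_le
  calc ‖T φ ψ‖ ≤ C * (A * Q / R) * R := hC φ ψ _ _ hφR hψR
    _ = C * A * Q := by field_simp

/-- A jointly continuous bilinear functional defines a unique continuous map into the strong
dual. -/
lemma existsUnique_of_continuous (K : Space M l →ₗ[ℂ] Space M s →ₗ[ℂ] ℂ)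
    (hK : Continuous fun p : Space M l × Space M s => K p.1 p.2) :
    ∃! T : Space M s →ₗ[ℂ] Dual M l,
      (∀ (φ : Space M s) (ψ : Space M l), T φ ψ = K ψ φ) ∧ Continuous T ∧
      ∀ u : ℕ → Space M s,
        Tendsto u atTop (𝓝 0) → Tendsto (fun j => T (u j)) atTop (𝓝 0) := by
  let T : Space M s →ₗ[ℂ] Dual M l :=
    { toFun := fun φ => ⟨K.flip φ, hK.comp (Continuous.prodMk continuous_id continuous_const)⟩
      map_add' := fun φ φ' => by ext ψ; exact map_add (K ψ) φ φ'
      map_smul' := fun c φ => by ext ψ; exact map_smul (K ψ) c φ }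
  have hT : Continuous T := ContinuousLinearMap.continuous_of_continuous_uncurry T
    (hK.comp continuous_swap)
  refine ⟨T, ⟨fun φ ψ => rfl, hT, fun u hu => ?_⟩, fun T' hT' => ?_⟩
  · have := (hT.tendsto 0).comp hu
    rwa [map_zero] at this
  · ext φ ψ
    exact hT'.1 φ ψ

end bilinear

/-! ### Weight sequences -/

namespace WeightSequence

variable (M : WeightSequence)

lemma sqrt_pow_le : ∃ C L : ℝ, 1 ≤ C ∧ 0 < L ∧ ∀ p : ℕ, √p ^ p ≤ C * L ^ p * M.seq p := by
  obtain ⟨C, L, hC, hL, h⟩ := M.nontrivial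
  refine ⟨max C 1, L, le_max_right _ _, hL, fun p => ?_⟩
  have h1 : √(p : ℝ) ^ p = (p : ℝ) ^ ((p : ℝ) / 2) := by
    rw [Real.sqrt_eq_rpow, ← Real.rpow_natCast, ← Real.rpow_mul (Nat.cast_nonneg p)]
    congr 1
    ring
  rw [h1]
  refine (h p).trans ?_
  have := M.seq_pos p
  gcongr
  exact le_max_left _ _

lemma seq_pow_succ_le (p : ℕ) : M.seq p ^ (p + 1) ≤ M.seq (p + 1) ^ p := by
  induction p with
  | zero => simp [M.seq_zero]
  | succ p ih =>
    have h0 := M.seq_pos p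
    have h1 := M.seq_pos (p + 1)
    have h2 := M.seq_pos (p + 1 + 1)
    have hlc := M.log_convex (p + 1) (by omega)
    simp only [Nat.add_sub_cancel] at hlc
    refine le_of_mul_le_mul_left ?_ (pow_pos h1 p)
    calc M.seq (p + 1) ^ p * M.seq (p + 1) ^ (p + 1 + 1)
        = (M.seq (p + 1) ^ 2) ^ (p + 1) := by ring
      _ ≤ (M.seq p * M.seq (p + 1 + 1)) ^ (p + 1) := by gcongr
      _ = M.seq p ^ (p + 1) * M.seq (p + 1 + 1) ^ (p + 1) := mul_pow _ _ _
      _ ≤ M.seq (p + 1) ^ p * M.seq (p + 1 + 1) ^ (p + 1) := by gcongr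

/-- Logarithmic convexity turns the lower bound (M.3)'' for `M_p` into the lower bound
`√(p + 1) ≲ M_{p+1} / M_p` for the quotients, of which this is a consequence. -/
lemma succ_mul_seq_le : ∃ κ : ℝ, 0 < κ ∧ ∀ p : ℕ, ((p : ℝ) + 1) * M.seq p ≤ κ * M.seq (p + 2) := by
  obtain ⟨C, L, hC, hL, h⟩ := M.sqrt_pow_le
  have hC0 : 0 < C := one_pos.trans_le hC
  refine ⟨(C * L) ^ 2, by positivity, fun p => ?_⟩
  have h0 := M.seq_pos p
  have h1 := M.seq_pos (p + 1)
  have h2 := M.seq_pos (p + 2)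
  have hlc := M.log_convex (p + 1) (by omega)
  simp only [Nat.add_sub_cancel] at hlc
  have hq : √((p : ℝ) + 1) * M.seq p ≤ C * L * M.seq (p + 1) := by
    refine le_of_pow_le_pow_left₀ (n := p + 1) (by omega) (by positivity) ?_
    have h3 := h (p + 1)
    push_cast at h3
    calc (√((p : ℝ) + 1) * M.seq p) ^ (p + 1)
        = √((p : ℝ) + 1) ^ (p + 1) * M.seq p ^ (p + 1) := mul_pow _ _ _
      _ ≤ (C * L ^ (p + 1) * M.seq (p + 1)) * M.seq (p + 1) ^ p := by
          gcongr
          exact M.seq_pow_succ_le p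
      _ ≤ (C ^ (p + 1) * L ^ (p + 1) * M.seq (p + 1)) * M.seq (p + 1) ^ p := by
          gcongr
          exact le_self_pow₀ hC (by omega)
      _ = (C * L * M.seq (p + 1)) ^ (p + 1) := by ring
  have hsq : (√((p : ℝ) + 1) * M.seq p) ^ 2 ≤ (C * L * M.seq (p + 1)) ^ 2 := by gcongr
  rw [mul_pow, mul_pow, Real.sq_sqrt (by positivity)] at hsq
  refine le_of_mul_le_mul_right ?_ h0
  calc ((p : ℝ) + 1) * M.seq p * M.seq p = ((p : ℝ) + 1) * M.seq p ^ 2 := by ring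
    _ ≤ (C * L) ^ 2 * M.seq (p + 1) ^ 2 := hsq
    _ ≤ (C * L) ^ 2 * (M.seq p * M.seq (p + 1 + 1)) := by gcongr
    _ = (C * L) ^ 2 * M.seq (p + 2) * M.seq p := by ring_nf

end WeightSequence

/-! ### Hermite functions of one variable -/

section oneVariable

open Polynomial MeasureTheory

/-- The Hermite polynomials, normalized so that the functions `P_n(x) e^{-x²/2}` are orthonormal
in `L²(ℝ)`. -/
noncomputable def hermitePoly : ℕ → ℝ[X]
  | 0 => C (√(√Real.pi))⁻¹
  | n + 1 => C (√(2 * ((n : ℝ) + 1)))⁻¹ * (2 * X * hermitePoly n - derivative (hermitePoly n))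

/-- The normalized Hermite function of one variable. -/
noncomputable def hermite₁ (n : ℕ) (x : ℝ) : ℝ := (hermitePoly n).eval x * Real.exp (-x ^ 2 / 2)

lemma hermitePoly_succ (n : ℕ) : C (√(2 * ((n : ℝ) + 1))) * hermitePoly (n + 1) =
    2 * X * hermitePoly n - derivative (hermitePoly n) := by
  have : √(2 * ((n : ℝ) + 1)) ≠ 0 := by positivity
  rw [hermitePoly, ← mul_assoc, ← C_mul, mul_inv_cancel₀ this, C_1, one_mul]

lemma derivative_hermitePoly (n : ℕ) :
    derivative (hermitePoly n) = C (√(2 * (n : ℝ))) * hermitePoly (n - 1) := by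
  induction n with
  | zero => simp [hermitePoly]
  | succ n ih =>
    have h0 : √(2 * ((n : ℝ) + 1)) ≠ 0 := by positivity
    have hsq : √(2 * ((n : ℝ) + 1)) * √(2 * ((n : ℝ) + 1)) = 2 * ((n : ℝ) + 1) :=
      Real.mul_self_sqrt (by positivity)
    refine mul_left_cancel₀ (C_ne_zero.2 h0) ?_
    rw [← derivative_C_mul, hermitePoly_succ]
    have h2 : derivative (derivative (hermitePoly n)) =
        2 * X * derivative (hermitePoly n) - C (2 * (n : ℝ)) * hermitePoly n := by
      rcases n with _ | n
      · simp [hermitePoly]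
      · have hn : √(2 * ((n : ℝ) + 1)) * √(2 * ((n : ℝ) + 1)) = 2 * ((n : ℝ) + 1) :=
          Real.mul_self_sqrt (by positivity)
        have h3 := hermitePoly_succ n
        simp only [Nat.add_sub_cancel, Nat.cast_add, Nat.cast_one] at ih ⊢
        rw [← hn, ih, derivative_C_mul, C_mul]
        linear_combination C (√(2 * ((n : ℝ) + 1))) * h3
    rw [← mul_assoc, Nat.cast_add, Nat.cast_one, ← C_mul, hsq, derivative_sub, h2]
    simp only [derivative_mul, derivative_X, derivative_ofNat, Nat.add_sub_cancel, C_mul, C_add,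
      C_1, map_ofNat]
    ring

lemma sqrt_two_mul (a : ℝ) : √(2 * a) = 2 * √(a / 2) := by
  rw [show 2 * a = 2 ^ 2 * (a / 2) by ring, Real.sqrt_mul (by positivity),
    Real.sqrt_sq (by norm_num)]

/-- The three-term recurrence. For `n = 0` the truncated index `n - 1` is harmless, since its
coefficient vanishes; the same applies to all formulas with lowered indices below. -/
lemma mul_hermite₁ (n : ℕ) (x : ℝ) :
    x * hermite₁ n x =
      √((n : ℝ) / 2) * hermite₁ (n - 1) x + √(((n : ℝ) + 1) / 2) * hermite₁ (n + 1) x := by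
  have h1 := congrArg (eval x) (hermitePoly_succ n)
  rw [derivative_hermitePoly] at h1
  simp only [eval_mul, eval_sub, eval_C, eval_X, eval_ofNat, sqrt_two_mul] at h1
  unfold hermite₁
  linear_combination (-Real.exp (-x ^ 2 / 2) / 2) * h1

lemma hasDerivAt_hermite₁ (n : ℕ) (x : ℝ) :
    HasDerivAt (hermite₁ n)
      (√((n : ℝ) / 2) * hermite₁ (n - 1) x - √(((n : ℝ) + 1) / 2) * hermite₁ (n + 1) x) x := by
  have h1 : HasDerivAt (fun x : ℝ => -x ^ 2 / 2) (-x) x := by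
    refine ((hasDerivAt_pow 2 x).neg.div_const 2).congr_deriv ?_
    norm_num
    ring
  have h2 := ((hermitePoly n).hasDerivAt x).mul h1.exp
  refine h2.congr_deriv ?_
  have h3 := mul_hermite₁ n x
  unfold hermite₁ at h3 ⊢
  rw [derivative_hermitePoly, sqrt_two_mul]
  simp only [eval_mul, eval_C]
  linear_combination (-1 : ℝ) * h3

lemma contDiff_hermite₁ (n : ℕ) : ContDiff ℝ ∞ (hermite₁ n) := by
  have h1 : ContDiff ℝ ∞ fun x : ℝ => (hermitePoly n).eval x := by
    simpa using Polynomial.contDiff_aeval (𝕜 := ℝ) (hermitePoly n) ∞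
  exact h1.mul (by fun_prop)

lemma continuous_hermite₁ (n : ℕ) : Continuous (hermite₁ n) := (contDiff_hermite₁ n).continuous

lemma exists_abs_eval_le (p : ℝ[X]) : ∃ C : ℝ, 0 ≤ C ∧ ∀ x, |p.eval x| ≤ C * Real.exp |x| := by
  induction p using Polynomial.induction_on' with
  | add p q hp hq =>
    obtain ⟨C, hC, h⟩ := hp
    obtain ⟨D, hD, h'⟩ := hq
    refine ⟨C + D, by positivity, fun x => ?_⟩
    rw [eval_add, add_mul]
    exact (abs_add_le _ _).trans (add_le_add (h x) (h' x))
  | monomial n a =>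
    refine ⟨|a| * n.factorial, by positivity, fun x => ?_⟩
    rw [eval_monomial, abs_mul, abs_pow, mul_assoc]
    gcongr
    have := Real.pow_div_factorial_le_exp |x| (abs_nonneg x) n
    rw [div_le_iff₀ (by positivity)] at this
    linarith

/-- Hermite functions beat every exponential, with a Gaussian factor left over. -/
lemma exists_exp_mul_hermite₁_le (n : ℕ) (c : ℝ) : ∃ C : ℝ, 0 ≤ C ∧
    ∀ x, Real.exp (c * |x|) * |hermite₁ n x| ≤ C * Real.exp (-(1 / 4) * x ^ 2) := by
  obtain ⟨C, hC, h⟩ := exists_abs_eval_le (hermitePoly n)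
  refine ⟨C * Real.exp ((c + 1) ^ 2), by positivity, fun x => ?_⟩
  unfold hermite₁
  rw [abs_mul, abs_of_pos (Real.exp_pos _)]
  calc Real.exp (c * |x|) * (|(hermitePoly n).eval x| * Real.exp (-x ^ 2 / 2))
      ≤ Real.exp (c * |x|) * ((C * Real.exp |x|) * Real.exp (-x ^ 2 / 2)) := by
        gcongr
        exact h x
    _ = C * Real.exp (c * |x| + |x| + -x ^ 2 / 2) := by
        rw [Real.exp_add, Real.exp_add]
        ring
    _ ≤ C * Real.exp ((c + 1) ^ 2 + -(1 / 4) * x ^ 2) := by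
        refine mul_le_mul_of_nonneg_left (Real.exp_le_exp.2 ?_) hC
        rw [← sq_abs x]
        nlinarith [sq_nonneg (c + 1 - |x| / 2)]
    _ = _ := by rw [Real.exp_add]; ring

lemma integrable_exp_mul_hermite₁ (n : ℕ) (c : ℝ) :
    Integrable fun x => Real.exp (c * |x|) * |hermite₁ n x| := by
  obtain ⟨C, -, h⟩ := exists_exp_mul_hermite₁_le n c
  refine Integrable.mono' ((integrable_exp_neg_mul_sq (b := 1 / 4) (by norm_num)).const_mul C)
    ?_ (Eventually.of_forall fun x => ?_)
  · have := continuous_hermite₁ n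
    exact Continuous.aestronglyMeasurable (by fun_prop)
  · rw [Real.norm_of_nonneg (by positivity)]
    exact h x

lemma exists_abs_hermite₁_le_const (n : ℕ) : ∃ C : ℝ, ∀ x, |hermite₁ n x| ≤ C := by
  obtain ⟨C, hC, h⟩ := exists_exp_mul_hermite₁_le n 0
  refine ⟨C, fun x => ?_⟩
  have h1 := h x
  rw [zero_mul, Real.exp_zero, one_mul] at h1
  refine h1.trans (mul_le_of_le_one_right hC (Real.exp_le_one_iff.2 ?_))
  nlinarith [sq_nonneg x]

lemma integrable_hermite₁ (n : ℕ) : Integrable (hermite₁ n) := by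
  have := integrable_exp_mul_hermite₁ n 0
  simp only [zero_mul, Real.exp_zero, one_mul] at this
  exact (integrable_norm_iff (continuous_hermite₁ n).aestronglyMeasurable).1 this

lemma integrable_hermite₁_mul (n k : ℕ) : Integrable fun x => hermite₁ n x * hermite₁ k x := by
  obtain ⟨C, h⟩ := exists_abs_hermite₁_le_const k
  exact (integrable_hermite₁ n).mul_bdd (continuous_hermite₁ k).aestronglyMeasurable
    (Eventually.of_forall h)

lemma integral_hermite₁_succ_mul (n k : ℕ) :
    √(((n : ℝ) + 1) / 2) * ∫ x, hermite₁ (n + 1) x * hermite₁ k x =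
      √((k : ℝ) / 2) * ∫ x, hermite₁ n x * hermite₁ (k - 1) x := by
  have hI := integrable_hermite₁_mul
  have hibp := integral_mul_deriv_eq_deriv_mul_of_integrable
    (fun x _ => hasDerivAt_hermite₁ n x) (fun x _ => hasDerivAt_hermite₁ k x)
    (by
      have := ((hI n (k - 1)).const_mul √((k : ℝ) / 2)).sub
        ((hI n (k + 1)).const_mul √(((k : ℝ) + 1) / 2))
      refine this.congr (Eventually.of_forall fun x => ?_)
      simp only [Pi.sub_apply, Pi.mul_apply]
      ring)
    (by
      have := ((hI (n - 1) k).const_mul √((n : ℝ) / 2)).sub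
        ((hI (n + 1) k).const_mul √(((n : ℝ) + 1) / 2))
      refine this.congr (Eventually.of_forall fun x => ?_)
      simp only [Pi.sub_apply, Pi.mul_apply]
      ring)
    (hI n k)
  have e1 : ∫ x, hermite₁ n x * (√((k : ℝ) / 2) * hermite₁ (k - 1) x -
      √(((k : ℝ) + 1) / 2) * hermite₁ (k + 1) x) =
      √((k : ℝ) / 2) * (∫ x, hermite₁ n x * hermite₁ (k - 1) x) -
        √(((k : ℝ) + 1) / 2) * ∫ x, hermite₁ n x * hermite₁ (k + 1) x := by
    rw [← integral_const_mul, ← integral_const_mul, ← integral_sub ((hI _ _).const_mul _)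
      ((hI _ _).const_mul _)]
    congr 1 with x
    ring
  have e2 : ∫ x, (√((n : ℝ) / 2) * hermite₁ (n - 1) x -
      √(((n : ℝ) + 1) / 2) * hermite₁ (n + 1) x) * hermite₁ k x =
      √((n : ℝ) / 2) * (∫ x, hermite₁ (n - 1) x * hermite₁ k x) -
        √(((n : ℝ) + 1) / 2) * ∫ x, hermite₁ (n + 1) x * hermite₁ k x := by
    rw [← integral_const_mul, ← integral_const_mul, ← integral_sub ((hI _ _).const_mul _)
      ((hI _ _).const_mul _)]
    congr 1 with x
    ring
  -- `∫ (x h_n) h_k = ∫ h_n (x h_k)`, expanded by the recurrence on both sides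
  have e3 : √((n : ℝ) / 2) * (∫ x, hermite₁ (n - 1) x * hermite₁ k x) +
        √(((n : ℝ) + 1) / 2) * ∫ x, hermite₁ (n + 1) x * hermite₁ k x =
      √((k : ℝ) / 2) * (∫ x, hermite₁ n x * hermite₁ (k - 1) x) +
        √(((k : ℝ) + 1) / 2) * ∫ x, hermite₁ n x * hermite₁ (k + 1) x := by
    simp only [← integral_const_mul]
    rw [← integral_add ((hI _ _).const_mul _) ((hI _ _).const_mul _),
      ← integral_add ((hI _ _).const_mul _) ((hI _ _).const_mul _)]
    congr 1 with x
    linear_combination (hermite₁ n x) * mul_hermite₁ k x - (hermite₁ k x) * mul_hermite₁ n x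
  rw [e1, e2] at hibp
  linear_combination (1 / 2) * e3 - (1 / 2) * hibp

lemma integral_hermite₁_mul (n k : ℕ) :
    ∫ x, hermite₁ n x * hermite₁ k x = if n = k then 1 else 0 := by
  have hsucc : ∀ n : ℕ, √(((n : ℝ) + 1) / 2) ≠ 0 := fun n => by positivity
  have hzero : ∀ n : ℕ, ∫ x, hermite₁ (n + 1) x * hermite₁ 0 x = 0 := fun n => by
    have h := integral_hermite₁_succ_mul n 0
    rw [Nat.cast_zero, zero_div, Real.sqrt_zero, zero_mul] at h
    exact (mul_eq_zero.1 h).resolve_left (hsucc n)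
  induction n generalizing k with
  | zero =>
    cases k with
    | zero =>
      have h0 : ∀ x : ℝ, hermite₁ 0 x * hermite₁ 0 x = (√Real.pi)⁻¹ * Real.exp (-1 * x ^ 2) := by
        intro x
        simp only [hermite₁, hermitePoly, eval_C]
        rw [mul_mul_mul_comm, ← Real.exp_add, ← mul_inv, Real.mul_self_sqrt (by positivity)]
        ring_nf
      simp only [h0]
      rw [integral_const_mul, integral_gaussian, div_one, inv_mul_cancel₀ (by positivity)]
      rfl
    | succ k =>
      rw [if_neg (by omega), ← hzero k]
      congr 1 with x
      ring
  | succ n ih =>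
    cases k with
    | zero => rw [hzero, if_neg (by omega)]
    | succ k =>
      have h := integral_hermite₁_succ_mul n (k + 1)
      rw [Nat.add_sub_cancel, ih k] at h
      by_cases hnk : n = k
      · subst hnk
        push_cast at h
        rw [if_pos rfl] at h ⊢
        exact mul_left_cancel₀ (hsucc n) h
      · rw [if_neg hnk, mul_zero] at h
        rw [if_neg (by omega)]
        exact (mul_eq_zero.1 h).resolve_left (hsucc n)

/-- A crude uniform bound, from `h_n(x)² = ∫_{-∞}^x 2 h_n h_n' ≤ ∫ (h_n² + h_n'²)`. -/
lemma abs_hermite₁_le (n : ℕ) (x : ℝ) : |hermite₁ n x| ≤ n + 2 := by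
  have hI := integrable_hermite₁_mul
  set D : ℝ → ℝ := fun x =>
    √((n : ℝ) / 2) * hermite₁ (n - 1) x - √(((n : ℝ) + 1) / 2) * hermite₁ (n + 1) x with hD
  have hderiv : ∀ x, HasDerivAt (fun x => hermite₁ n x * hermite₁ n x)
      (D x * hermite₁ n x + hermite₁ n x * D x) x := fun x =>
    (hasDerivAt_hermite₁ n x).mul (hasDerivAt_hermite₁ n x)
  have hDint : Integrable fun x => D x * hermite₁ n x + hermite₁ n x * D x := by
    have h1 : Integrable fun x => D x * hermite₁ n x := by
      have := ((hI (n - 1) n).const_mul √((n : ℝ) / 2)).sub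
        ((hI (n + 1) n).const_mul √(((n : ℝ) + 1) / 2))
      refine this.congr (Eventually.of_forall fun x => ?_)
      simp only [Pi.sub_apply, hD]
      ring
    exact h1.add (h1.congr (Eventually.of_forall fun x => mul_comm _ _))
  set G : ℝ → ℝ := fun x => hermite₁ n x * hermite₁ n x +
    ((n : ℝ) * (hermite₁ (n - 1) x * hermite₁ (n - 1) x) +
      ((n : ℝ) + 1) * (hermite₁ (n + 1) x * hermite₁ (n + 1) x)) with hG
  have hGint : Integrable G :=
    (hI n n).add (((hI _ _).const_mul _).add ((hI _ _).const_mul _))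
  have hGval : ∫ x, G x = 2 * n + 2 := by
    rw [hG]
    have e1 := integral_add (hI n n) (((hI (n - 1) (n - 1)).const_mul (n : ℝ)).add
      ((hI (n + 1) (n + 1)).const_mul ((n : ℝ) + 1)))
    have e2 := integral_add ((hI (n - 1) (n - 1)).const_mul (n : ℝ))
      ((hI (n + 1) (n + 1)).const_mul ((n : ℝ) + 1))
    refine e1.trans ((congrArg _ e2).trans ?_)
    rw [integral_const_mul, integral_const_mul]
    simp only [integral_hermite₁_mul, if_true]
    ring
  have hle : ∀ x, D x * hermite₁ n x + hermite₁ n x * D x ≤ G x := fun x => by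
    have h1 : √((n : ℝ) / 2) ^ 2 = n / 2 := Real.sq_sqrt (by positivity)
    have h2 : √(((n : ℝ) + 1) / 2) ^ 2 = (n + 1) / 2 := Real.sq_sqrt (by positivity)
    have h3 : D x ^ 2 ≤ (n : ℝ) * (hermite₁ (n - 1) x * hermite₁ (n - 1) x) +
        ((n : ℝ) + 1) * (hermite₁ (n + 1) x * hermite₁ (n + 1) x) := by
      have : D x ^ 2 ≤ 2 * (√((n : ℝ) / 2) * hermite₁ (n - 1) x) ^ 2 +
          2 * (√(((n : ℝ) + 1) / 2) * hermite₁ (n + 1) x) ^ 2 := by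
        rw [hD]
        nlinarith [sq_nonneg (√((n : ℝ) / 2) * hermite₁ (n - 1) x +
          √(((n : ℝ) + 1) / 2) * hermite₁ (n + 1) x)]
      rw [mul_pow, mul_pow, h1, h2] at this
      linarith
    rw [hG]
    nlinarith [sq_nonneg (D x - hermite₁ n x)]
  have hG0 : ∀ x, 0 ≤ G x := fun x => by
    have a := mul_self_nonneg (hermite₁ n x)
    have b := mul_self_nonneg (hermite₁ (n - 1) x)
    have c := mul_self_nonneg (hermite₁ (n + 1) x)
    positivity
  have hlim : Tendsto (fun x => hermite₁ n x * hermite₁ n x) atBot (𝓝 0) :=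
    tendsto_zero_of_hasDerivAt_of_integrableOn_Iic (a := 0) (fun x _ => hderiv x)
      hDint.integrableOn (hI n n).integrableOn
  have hftc := integral_Iic_of_hasDerivAt_of_tendsto' (a := x) (fun x _ => hderiv x)
    hDint.integrableOn hlim
  have hsq : hermite₁ n x * hermite₁ n x ≤ 2 * n + 2 := by
    rw [sub_zero] at hftc
    rw [← hftc, ← hGval]
    exact (setIntegral_mono hDint.integrableOn hGint.integrableOn hle).trans
      (setIntegral_le_integral hGint (Eventually.of_forall hG0))
  refine abs_le_of_sq_le_sq ?_ (by positivity)
  nlinarith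

end oneVariable

/-! ### Hermite functions of several variables -/

section severalVariables

variable {d : ℕ}

/-- The Hermite function `h_n(x) = ∏ i, h_{n_i}(x_i)` of several variables. -/
noncomputable def hermiteFun (n : Fin d → ℕ) (x : Fin d → ℝ) : ℂ :=
  ((∏ i, hermite₁ (n i) (x i) : ℝ) : ℂ)

lemma hermiteFun_eq_mul (n : Fin d → ℕ) (i : Fin d) (x : Fin d → ℝ) :
    hermiteFun n x =
      ((hermite₁ (n i) (x i) * ∏ j ∈ Finset.univ.erase i, hermite₁ (n j) (x j) : ℝ) : ℂ) := by
  rw [hermiteFun, Finset.mul_prod_erase _ (fun j => hermite₁ (n j) (x j)) (Finset.mem_univ i)]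

lemma hermiteFun_update (n : Fin d → ℕ) (i : Fin d) (a : ℕ) (x : Fin d → ℝ) :
    hermiteFun (Function.update n i a) x =
      ((hermite₁ a (x i) * ∏ j ∈ Finset.univ.erase i, hermite₁ (n j) (x j) : ℝ) : ℂ) := by
  rw [hermiteFun_eq_mul _ i, Function.update_self]
  congr 2
  refine Finset.prod_congr rfl fun j hj => ?_
  rw [Function.update_of_ne (Finset.ne_of_mem_erase hj)]

lemma contDiff_hermiteFun (n : Fin d → ℕ) : ContDiff ℝ ∞ (hermiteFun n) := by
  have h : ContDiff ℝ ∞ fun x : Fin d → ℝ => ∏ i, hermite₁ (n i) (x i) :=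
    contDiff_prod fun i _ => (contDiff_hermite₁ (n i)).comp (contDiff_apply ℝ ℝ i)
  exact Complex.ofRealCLM.contDiff.comp h

lemma hasLineDerivAt_hermiteFun (n : Fin d → ℕ) (i : Fin d) (x : Fin d → ℝ) :
    HasLineDerivAt ℝ (hermiteFun n)
      ((√((n i : ℝ) / 2) : ℂ) * hermiteFun (Function.update n i (n i - 1)) x -
        (√(((n i : ℝ) + 1) / 2) : ℂ) * hermiteFun (Function.update n i (n i + 1)) x)
      x (Pi.single i 1) := by
  unfold HasLineDerivAt
  have h1 : (fun t : ℝ => hermiteFun n (x + t • Pi.single i 1)) = fun t : ℝ =>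
      ((hermite₁ (n i) (x i + t) * ∏ j ∈ Finset.univ.erase i, hermite₁ (n j) (x j) : ℝ) : ℂ) := by
    funext t
    rw [hermiteFun_eq_mul n i]
    congr 2
    · simp
    · refine Finset.prod_congr rfl fun j hj => ?_
      simp [Finset.ne_of_mem_erase hj]
  rw [h1]
  have h2 : HasDerivAt (fun t : ℝ => hermite₁ (n i) (x i + t)) _ 0 :=
    HasDerivAt.comp_const_add (x i) 0 (hasDerivAt_hermite₁ (n i) (x i + 0))
  refine ((h2.mul_const (∏ j ∈ Finset.univ.erase i,
    hermite₁ (n j) (x j))).ofReal_comp).congr_deriv ?_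
  rw [hermiteFun_update, hermiteFun_update, add_zero]
  push_cast
  ring

lemma pderiv_hermiteFun (n : Fin d → ℕ) (i : Fin d) :
    pderiv i (hermiteFun n) =
      (√((n i : ℝ) / 2) : ℂ) • hermiteFun (Function.update n i (n i - 1)) +
        (-(√(((n i : ℝ) + 1) / 2) : ℂ)) • hermiteFun (Function.update n i (n i + 1)) := by
  funext x
  rw [pderiv, (hasLineDerivAt_hermiteFun n i x).lineDeriv]
  simp only [Pi.add_apply, Pi.smul_apply, smul_eq_mul]
  ring

lemma mul_hermiteFun (n : Fin d → ℕ) (i : Fin d) (x : Fin d → ℝ) :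
    (x i : ℂ) * hermiteFun n x =
      (√((n i : ℝ) / 2) : ℂ) * hermiteFun (Function.update n i (n i - 1)) x +
        (√(((n i : ℝ) + 1) / 2) : ℂ) * hermiteFun (Function.update n i (n i + 1)) x := by
  have h := congrArg (fun r : ℝ => (r : ℂ)) (mul_hermite₁ (n i) (x i))
  rw [hermiteFun_update, hermiteFun_update, hermiteFun_eq_mul n i]
  push_cast at h ⊢
  rw [← mul_assoc, h]
  ring

lemma le_len (n : Fin d → ℕ) (i : Fin d) : n i ≤ len n :=
  Finset.single_le_sum (f := n) (fun _ _ => Nat.zero_le _) (Finset.mem_univ i)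

lemma len_update_le (n : Fin d → ℕ) (i : Fin d) {a : ℕ} (ha : a ≤ n i + 1) :
    len (Function.update n i a) ≤ len n + 1 := by
  have h1 : len (Function.update n i a) = a + ∑ j ∈ Finset.univ.erase i, n j := by
    unfold len
    rw [← Finset.add_sum_erase _ _ (Finset.mem_univ i), Function.update_self]
    congr 1
    exact Finset.sum_congr rfl fun j hj => Function.update_of_ne (Finset.ne_of_mem_erase hj) _ _
  have h2 : len n = n i + ∑ j ∈ Finset.univ.erase i, n j :=
    (Finset.add_sum_erase _ _ (Finset.mem_univ i)).symm
  omega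

lemma norm_hermiteFun_le (n : Fin d → ℕ) (x : Fin d → ℝ) :
    ‖hermiteFun n x‖ ≤ ((len n : ℝ) + 2) ^ d := by
  rw [hermiteFun, Complex.norm_real, Real.norm_eq_abs, Finset.abs_prod]
  calc ∏ i, |hermite₁ (n i) (x i)| ≤ ∏ _i : Fin d, ((len n : ℝ) + 2) := by
        refine Finset.prod_le_prod (fun _ _ => abs_nonneg _) fun i _ => ?_
        refine (abs_hermite₁_le _ _).trans ?_
        gcongr
        exact le_len n i
    _ = _ := by simp

/-- `IsComb q c u` states that `u` is a linear combination of the Hermite functions of total degree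
at most `q`, the absolute values of the coefficients having sum at most `c`. -/
inductive IsComb : ℕ → ℝ → ((Fin d → ℝ) → ℂ) → Prop
  | basis (n : Fin d → ℕ) : IsComb (len n) 1 (hermiteFun n)
  | add {q : ℕ} {a b : ℝ} {u v : (Fin d → ℝ) → ℂ} :
      IsComb q a u → IsComb q b v → IsComb q (a + b) (u + v)
  | smul {q : ℕ} {a : ℝ} {u : (Fin d → ℝ) → ℂ} (c : ℂ) :
      IsComb q a u → IsComb q (‖c‖ * a) (c • u)
  | mono {q q' : ℕ} {a a' : ℝ} {u : (Fin d → ℝ) → ℂ} :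
      IsComb q a u → q ≤ q' → a ≤ a' → IsComb q' a' u

namespace IsComb

variable {q : ℕ} {c : ℝ} {u : (Fin d → ℝ) → ℂ}

lemma contDiff (h : IsComb q c u) : ContDiff ℝ ∞ u := by
  induction h with
  | basis n => exact contDiff_hermiteFun n
  | add _ _ h1 h2 => exact h1.add h2
  | smul c _ h1 => exact contDiff_const.smul h1
  | mono _ _ _ h1 => exact h1

lemma nonneg (h : IsComb q c u) : 0 ≤ c := by
  induction h with
  | basis n => exact zero_le_one
  | add _ _ h1 h2 => exact add_nonneg h1 h2
  | smul c _ h1 => exact mul_nonneg (norm_nonneg c) h1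
  | mono _ _ h h1 => exact h1.trans h

lemma norm_le (h : IsComb q c u) (x : Fin d → ℝ) : ‖u x‖ ≤ c * ((q : ℝ) + 2) ^ d := by
  induction h with
  | basis n => simpa using norm_hermiteFun_le n x
  | add _ _ h1 h2 =>
    rw [add_mul]
    exact (norm_add_le _ _).trans (add_le_add h1 h2)
  | smul c _ h1 =>
    rw [Pi.smul_apply, norm_smul, mul_assoc]
    exact mul_le_mul_of_nonneg_left h1 (norm_nonneg c)
  | mono h hq hc h1 =>
    have := h.nonneg.trans hc
    refine h1.trans ?_
    gcongr

/-- The lowering and raising parts, with coefficients of size `√(n_i / 2)` and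
`√((n_i + 1) / 2)`. -/
lemma ladder (n : Fin d → ℕ) (i : Fin d) (ε : ℂ) (hε : ‖ε‖ = 1) :
    IsComb (len n + 1) (2 * √((len n : ℝ) + 1))
      ((√((n i : ℝ) / 2) : ℂ) • hermiteFun (Function.update n i (n i - 1)) +
        (ε * (√(((n i : ℝ) + 1) / 2) : ℂ)) • hermiteFun (Function.update n i (n i + 1))) := by
  have h1 := ((basis (Function.update n i (n i - 1))).mono
    (len_update_le n i (by omega)) le_rfl).smul (√((n i : ℝ) / 2) : ℂ)
  have h2 := ((basis (Function.update n i (n i + 1))).mono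
    (len_update_le n i le_rfl) le_rfl).smul (ε * (√(((n i : ℝ) + 1) / 2) : ℂ))
  refine (h1.add h2).mono le_rfl ?_
  have hi : (n i : ℝ) ≤ len n := by exact_mod_cast le_len n i
  have hi0 : (0 : ℝ) ≤ n i := Nat.cast_nonneg _
  rw [norm_mul, hε, one_mul, mul_one, mul_one, Complex.norm_real, Complex.norm_real,
    Real.norm_of_nonneg (Real.sqrt_nonneg _), Real.norm_of_nonneg (Real.sqrt_nonneg _), two_mul]
  gcongr <;> linarith

lemma pderiv (h : IsComb q c u) (i : Fin d) :
    IsComb (q + 1) (c * (3 * √((q : ℝ) + 1))) (pderiv i u) := by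
  induction h with
  | basis n =>
    rw [pderiv_hermiteFun, neg_eq_neg_one_mul]
    refine (ladder n i (-1) (by simp)).mono le_rfl ?_
    rw [one_mul]
    gcongr
    norm_num
  | add h1 h2 ih1 ih2 =>
    rw [pderiv_add i h1.contDiff h2.contDiff, add_mul]
    exact ih1.add ih2
  | smul c h1 ih1 =>
    rw [pderiv_smul i c h1.contDiff, mul_assoc]
    exact ih1.smul c
  | mono h hq hc h1 =>
    have := h.nonneg.trans hc
    refine h1.mono (by omega) ?_
    gcongr

lemma mul (h : IsComb q c u) (i : Fin d) :
    IsComb (q + 1) (c * (3 * √((q : ℝ) + 1))) (fun x => ((x i : ℂ) + Complex.I) * u x) := by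
  induction h with
  | basis n =>
    have h1 := (ladder n i 1 (by simp)).add
      (((basis n).mono (Nat.le_succ _) le_rfl).smul Complex.I)
    have h2 : (fun x : Fin d → ℝ => ((x i : ℂ) + Complex.I) * hermiteFun n x) =
        (√((n i : ℝ) / 2) : ℂ) • hermiteFun (Function.update n i (n i - 1)) +
          (1 * (√(((n i : ℝ) + 1) / 2) : ℂ)) • hermiteFun (Function.update n i (n i + 1)) +
          Complex.I • hermiteFun n := by
      funext x
      rw [add_mul, mul_hermiteFun n i x]
      simp only [Pi.add_apply, Pi.smul_apply, smul_eq_mul, one_mul]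
    rw [h2]
    refine h1.mono le_rfl ?_
    have h3 : (1 : ℝ) ≤ √((len n : ℝ) + 1) := Real.one_le_sqrt.2 (by simp)
    rw [Complex.norm_I]
    linarith
  | add h1 h2 ih1 ih2 =>
    rw [add_mul]
    convert ih1.add ih2 using 1
    funext x
    simp only [Pi.add_apply]
    ring
  | smul c h1 ih1 =>
    rw [mul_assoc]
    have := ih1.smul c
    convert this using 1
    funext x
    simp only [Pi.smul_apply, smul_eq_mul]
    ring
  | mono h hq hc h1 =>
    have := h.nonneg.trans hc
    refine h1.mono (by omega) ?_
    gcongr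

lemma step_le {Q : ℕ} (hc : 0 ≤ c) (hq : q + 1 ≤ Q) :
    c * (3 * √((q : ℝ) + 1)) ≤ c * (3 * √(Q : ℝ)) := by
  have : (q : ℝ) + 1 ≤ Q := by exact_mod_cast hq
  gcongr

lemma iter (i : Fin d) {Q : ℕ} (a : ℕ) (h : IsComb q c u) (hq : q + a ≤ Q) :
    IsComb (q + a) (c * (3 * √(Q : ℝ)) ^ a) ((GelfandShilov.pderiv i)^[a] u) := by
  induction a generalizing q c u with
  | zero => simpa using h
  | succ a ih =>
    rw [Function.iterate_succ_apply]
    have h1 := ih ((h.pderiv i).mono le_rfl (step_le (Q := Q) h.nonneg (by omega))) (by omega)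
    convert h1 using 1
    · omega
    · ring

lemma mderiv (α : Fin d → ℕ) {Q : ℕ} (h : IsComb q c u) (hq : q + len α ≤ Q) :
    IsComb (q + len α) (c * (3 * √(Q : ℝ)) ^ len α) (mderiv α u) := by
  have key : ∀ L : List (Fin d), q + (L.map α).sum ≤ Q →
      IsComb (q + (L.map α).sum) (c * (3 * √(Q : ℝ)) ^ (L.map α).sum)
        (L.foldr (fun i g => (GelfandShilov.pderiv i)^[α i] g) u) := by
    intro L
    induction L with
    | nil => intro _; simpa using h
    | cons i L ih =>
      intro hL
      simp only [List.map_cons, List.sum_cons, List.foldr_cons] at hL ⊢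
      have h1 := (ih (by omega)).iter i (α i) (Q := Q) (by omega)
      convert h1 using 1
      · omega
      · ring
  have hlen : len α = ((List.finRange d).map α).sum := Fin.sum_univ_def α
  rw [hlen] at hq ⊢
  exact key _ hq

lemma prod_mul (β : Fin d → ℕ) {Q : ℕ} (h : IsComb q c u) (hq : q + len β ≤ Q) :
    IsComb (q + len β) (c * (3 * √(Q : ℝ)) ^ len β)
      (fun x => (∏ i, ((x i : ℂ) + Complex.I) ^ β i) * u x) := by
  have hpow : ∀ (i : Fin d) (b : ℕ) {q : ℕ} {c : ℝ} {u : (Fin d → ℝ) → ℂ}, IsComb q c u →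
      q + b ≤ Q → IsComb (q + b) (c * (3 * √(Q : ℝ)) ^ b)
        (fun x => ((x i : ℂ) + Complex.I) ^ b * u x) := by
    intro i b
    induction b with
    | zero => intro q c u h _; simpa using h
    | succ b ih =>
      intro q c u h hq
      have h1 := ih ((h.mul i).mono le_rfl (step_le (Q := Q) h.nonneg (by omega))) (by omega)
      convert h1 using 1
      · omega
      · ring
      · funext x; ring
  have key : ∀ s : Finset (Fin d), q + ∑ i ∈ s, β i ≤ Q →
      IsComb (q + ∑ i ∈ s, β i) (c * (3 * √(Q : ℝ)) ^ (∑ i ∈ s, β i))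
        (fun x => (∏ i ∈ s, ((x i : ℂ) + Complex.I) ^ β i) * u x) := by
    intro s
    induction s using Finset.induction_on with
    | empty => intro _; simpa using h
    | insert i s his ih =>
      intro hs
      rw [Finset.sum_insert his] at hs ⊢
      have h1 := hpow i (β i) (ih (by omega)) (by omega)
      convert h1 using 1
      · omega
      · ring
      · funext x
        rw [Finset.prod_insert his]
        ring
  exact key _ hq

end IsComb

lemma norm_add_I_pow (x : ℝ) (b : ℕ) :
    ‖((x : ℂ) + Complex.I) ^ b‖ = (1 + x ^ 2) ^ ((b : ℝ) / 2) := by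
  have h1 : ‖(x : ℂ) + Complex.I‖ = √(1 + x ^ 2) := by
    have := Complex.norm_add_mul_I x 1
    simpa [add_comm] using this
  rw [norm_pow, h1, Real.sqrt_eq_rpow, ← Real.rpow_natCast, ← Real.rpow_mul (by positivity)]
  congr 1
  ring

lemma wt_eq_norm (β : Fin d → ℕ) (x : Fin d → ℝ) :
    wt β x = ‖∏ i, ((x i : ℂ) + Complex.I) ^ β i‖ := by
  rw [norm_prod]
  exact Finset.prod_congr rfl fun i _ => (norm_add_I_pow (x i) (β i)).symm

/-- The growth of the Hermite functions in the weighted sup-norms. It is `(|n| + p)^{p/2}`, up to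
exponential factors in `p = |α| + |β|` and polynomial ones in `|n| + p`. -/
lemma wt_mul_norm_mderiv_hermiteFun_le (n α β : Fin d → ℕ) (x : Fin d → ℝ) :
    wt β x * ‖mderiv α (hermiteFun n) x‖ ≤
      (3 * √((len n : ℝ) + (len α + len β : ℕ))) ^ (len α + len β) *
        ((len n : ℝ) + (len α + len β : ℕ) + 2) ^ d := by
  have h := ((IsComb.basis n).mderiv α (Q := len n + (len α + len β)) (by omega)).prod_mul β
    (by omega : len n + len α + len β ≤ len n + (len α + len β))
  have h1 := h.norm_le x
  rw [norm_mul, ← wt_eq_norm] at h1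
  refine h1.trans (le_of_eq ?_)
  push_cast
  ring

end severalVariables

/-! ### Decay of the Hermite coefficients -/

section coefficients

open MeasureTheory

variable {d : ℕ}

/-- The operator `x_i + ∂/∂x_i`, which lowers the index `n_i` of a Hermite function. -/
noncomputable def lower (i : Fin d) (g : (Fin d → ℝ) → ℂ) : (Fin d → ℝ) → ℂ :=
  (fun x => (x i : ℂ) * g x) + pderiv i g

lemma contDiff_coord_mul (i : Fin d) {g : (Fin d → ℝ) → ℂ} (hg : ContDiff ℝ ∞ g) :
    ContDiff ℝ ∞ fun x : Fin d → ℝ => (x i : ℂ) * g x :=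
  (Complex.ofRealCLM.contDiff.comp (contDiff_apply ℝ ℝ i)).mul hg

lemma lower_contDiff (i : Fin d) {g : (Fin d → ℝ) → ℂ} (hg : ContDiff ℝ ∞ g) :
    ContDiff ℝ ∞ (lower i g) :=
  (contDiff_coord_mul i hg).add (pderiv_contDiff i hg)

lemma lower_iterate_contDiff (i : Fin d) (k : ℕ) {g : (Fin d → ℝ) → ℂ} (hg : ContDiff ℝ ∞ g) :
    ContDiff ℝ ∞ ((lower i)^[k] g) := by
  induction k generalizing g with
  | zero => exact hg
  | succ k ih => exact ih (lower_contDiff i hg)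

lemma hasLineDerivAt_pderiv (i : Fin d) {g : (Fin d → ℝ) → ℂ} (hg : ContDiff ℝ ∞ g)
    (x : Fin d → ℝ) : HasLineDerivAt ℝ g (pderiv i g x) x (Pi.single i 1) :=
  ((hg.differentiable (by simp)) x).lineDifferentiableAt.hasLineDerivAt

lemma pderiv_coord_mul (i : Fin d) {g : (Fin d → ℝ) → ℂ} (hg : ContDiff ℝ ∞ g) :
    pderiv i (fun x => (x i : ℂ) * g x) = g + fun x => (x i : ℂ) * pderiv i g x := by
  funext x
  have h1 : HasDerivAt (fun t : ℝ => (((x + t • Pi.single i 1 : Fin d → ℝ) i : ℝ) : ℂ)) 1 0 := by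
    have h2 : (fun t : ℝ => (((x + t • Pi.single i 1 : Fin d → ℝ) i : ℝ) : ℂ)) =
        fun t : ℝ => ((x i + t : ℝ) : ℂ) := by
      funext t
      simp
    rw [h2]
    simpa using ((hasDerivAt_id (0 : ℝ)).const_add (x i)).ofReal_comp
  have h3 := h1.mul (hasLineDerivAt_pderiv i hg x)
  have h4 : pderiv i (fun x => (x i : ℂ) * g x) x = _ := HasDerivAt.deriv h3
  rw [h4]
  simp

lemma iterate_pderiv_coord_mul (i : Fin d) (a : ℕ) {g : (Fin d → ℝ) → ℂ} (hg : ContDiff ℝ ∞ g) :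
    (pderiv i)^[a] (fun x => (x i : ℂ) * g x) =
      (fun x => (x i : ℂ) * (pderiv i)^[a] g x) + (a : ℂ) • (pderiv i)^[a - 1] g := by
  induction a with
  | zero => simp
  | succ a ih =>
    have hsm : ContDiff ℝ ∞ ((a : ℂ) • (pderiv i)^[a - 1] g) :=
      contDiff_const.smul (iter_contDiff i (a - 1) hg)
    rw [Function.iterate_succ_apply', ih,
      pderiv_add i (contDiff_coord_mul i (iter_contDiff i a hg)) hsm,
      pderiv_coord_mul i (iter_contDiff i a hg), pderiv_smul i _ (iter_contDiff i _ hg),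
      Nat.add_sub_cancel]
    have h1 : (a : ℂ) • pderiv i ((pderiv i)^[a - 1] g) = (a : ℂ) • (pderiv i)^[a] g := by
      rcases a with _ | a
      · simp
      · rw [Nat.add_sub_cancel, ← Function.iterate_succ_apply' (pderiv i)]
    rw [h1]
    simp only [← Function.iterate_succ_apply' (pderiv i)]
    funext x
    simp only [Pi.add_apply, Pi.smul_apply, smul_eq_mul]
    push_cast
    ring

lemma iterate_pderiv_lower (i : Fin d) (a : ℕ) {g : (Fin d → ℝ) → ℂ} (hg : ContDiff ℝ ∞ g)
    (x : Fin d → ℝ) : (pderiv i)^[a] (lower i g) x =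
      (x i : ℂ) * (pderiv i)^[a] g x + a * (pderiv i)^[a - 1] g x + (pderiv i)^[a + 1] g x := by
  rw [lower, iter_add i a (contDiff_coord_mul i hg) (pderiv_contDiff i hg),
    iterate_pderiv_coord_mul i a hg, ← Function.iterate_succ_apply (pderiv i)]
  rfl

lemma mderiv_single (i : Fin d) (a : ℕ) (f : (Fin d → ℝ) → ℂ) :
    mderiv (Pi.single i a) f = (pderiv i)^[a] f := by
  have key : ∀ L : List (Fin d), L.Nodup →
      L.foldr (fun j g => (pderiv j)^[(Pi.single i a : Fin d → ℕ) j] g) f =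
        if i ∈ L then (pderiv i)^[a] f else f := by
    intro L
    induction L with
    | nil => intro _; simp
    | cons j L ih =>
      intro hL
      rw [List.nodup_cons] at hL
      rw [List.foldr_cons, ih hL.2]
      by_cases hij : j = i
      · subst hij
        simp [hL.1]
      · simp [hij, Ne.symm hij]
  rw [mderiv, key _ (List.nodup_finRange d), if_pos (List.mem_finRange i)]

lemma wt_add (β γ : Fin d → ℕ) (x : Fin d → ℝ) : wt (β + γ) x = wt β x * wt γ x := by
  simp only [wt_eq_norm, Pi.add_apply, pow_add, Finset.prod_mul_distrib, norm_mul]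

lemma one_le_norm_add_I (x : ℝ) : 1 ≤ ‖(x : ℂ) + Complex.I‖ := by
  simpa using Complex.abs_im_le_norm ((x : ℂ) + Complex.I)

lemma one_le_wt (β : Fin d → ℕ) (x : Fin d → ℝ) : 1 ≤ wt β x := by
  rw [wt_eq_norm, norm_prod]
  refine Finset.prod_induction _ (fun r => (1 : ℝ) ≤ r)
    (fun a b ha hb => one_le_mul_of_one_le_of_one_le ha hb) le_rfl fun i _ => ?_
  rw [norm_pow]
  exact one_le_pow₀ (one_le_norm_add_I _)

lemma abs_coord_le_wt_single (i : Fin d) (x : Fin d → ℝ) : |x i| ≤ wt (Pi.single i 1) x := by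
  rw [wt_eq_norm, Finset.prod_eq_single i (fun j _ hj => by simp [hj]) (by simp)]
  simpa using Complex.abs_re_le_norm ((x i : ℂ) + Complex.I)

lemma len_single (i : Fin d) (a : ℕ) : len (Pi.single i a : Fin d → ℕ) = a := by
  simp [len]

lemma len_add (α β : Fin d → ℕ) : len (α + β) = len α + len β := Finset.sum_add_distrib

lemma len_two : len (2 : Fin d → ℕ) = 2 * d := by
  simp [len, mul_comm]

/-- The estimate behind the decay of the Hermite coefficients. Each application of `x_i + ∂_i` costs
a constant and one index of the weight sequence; the commutator `a ∂_i^{a-1}` is absorbed by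
`a M_{p-1} ≤ κ M_{p+1}`, valid for `a ≤ p`. -/
lemma exists_iterate_lower_le (M : WeightSequence) {m : ℝ} (hm : 0 < m) : ∃ D : ℝ, 0 < D ∧
    ∀ {d : ℕ} {f : (Fin d → ℝ) → ℂ} {Q : ℝ}, ContDiff ℝ ∞ f → NormLE M m Q f →
      ∀ (i : Fin d) (k a b : ℕ) (x : Fin d → ℝ),
        wt (Pi.single i b + 2) x * ‖(pderiv i)^[a] ((lower i)^[k] f) x‖ ≤
          Q * D ^ k * m⁻¹ ^ (a + b + 2 * d) * M.seq (a + b + k + 2 * d) := by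
  obtain ⟨κ, hκ, hκM⟩ := M.succ_mul_seq_le
  refine ⟨2 * m⁻¹ + κ * m, by positivity, ?_⟩
  intro d f Q hf hQ i k
  have hQ0 := hQ.nonneg
  set ρ := m⁻¹ with hρ
  have hρ0 : 0 < ρ := inv_pos.2 hm
  set D := 2 * ρ + κ * m with hD
  have hD0 : 0 < D := by positivity
  induction k with
  | zero =>
    intro a b x
    have h1 := hQ (Pi.single i a) (Pi.single i b + 2) x
    rw [term, mderiv_single, len_add, len_single, len_single, len_two] at h1
    have p1 := M.seq_pos a
    have p2 := M.seq_pos (b + 2 * d)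
    have p3 : 0 < m ^ (a + (b + 2 * d)) := pow_pos hm _
    rw [div_mul_eq_mul_div, div_le_iff₀ (by positivity), ← le_div_iff₀' p3] at h1
    refine h1.trans ?_
    rw [div_eq_mul_inv, ← inv_pow, ← hρ]
    calc Q * (M.seq a * M.seq (b + 2 * d)) * ρ ^ (a + (b + 2 * d))
        ≤ Q * M.seq (a + (b + 2 * d)) * ρ ^ (a + (b + 2 * d)) := by
          gcongr
          exact seq_mul_le M _ _
      _ = _ := by
          rw [← add_assoc]
          simp only [pow_zero, add_zero]
          ring
  | succ k ih =>
    intro a b x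
    have hg := lower_iterate_contDiff i k hf
    rw [Function.iterate_succ_apply' (lower i), iterate_pderiv_lower i a hg]
    set g := (lower i)^[k] f with hgdef
    have hw := wt_nonneg (Pi.single i b + 2) x
    have hP := M.seq_pos (a + b + (k + 1) + 2 * d)
    -- the three terms produced by `∂^a (x + ∂) = x ∂^a + a ∂^{a-1} + ∂^{a+1}`
    have t1 : wt (Pi.single i b + 2) x * ‖(x i : ℂ) * (pderiv i)^[a] g x‖ ≤
        Q * D ^ k * ρ ^ (a + b + 2 * d) * M.seq (a + b + (k + 1) + 2 * d) * ρ := by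
      have h1 := ih a (b + 1) x
      have h2 : wt (Pi.single i (b + 1) + 2) x =
          wt (Pi.single i b + 2) x * wt (Pi.single i 1) x := by
        rw [← wt_add, Pi.single_add]
        congr 1
        abel
      rw [h2, show a + (b + 1) + k + 2 * d = a + b + (k + 1) + 2 * d by ring] at h1
      rw [norm_mul, Complex.norm_real, Real.norm_eq_abs]
      calc wt (Pi.single i b + 2) x * (|x i| * ‖(pderiv i)^[a] g x‖)
          ≤ wt (Pi.single i b + 2) x * (wt (Pi.single i 1) x * ‖(pderiv i)^[a] g x‖) := by
            gcongr
            exact abs_coord_le_wt_single i x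
        _ = wt (Pi.single i b + 2) x * wt (Pi.single i 1) x * ‖(pderiv i)^[a] g x‖ := by ring
        _ ≤ _ := h1
        _ = _ := by ring
    have t2 : wt (Pi.single i b + 2) x * ‖(pderiv i)^[a + 1] g x‖ ≤
        Q * D ^ k * ρ ^ (a + b + 2 * d) * M.seq (a + b + (k + 1) + 2 * d) * ρ := by
      have h1 := ih (a + 1) b x
      rw [show a + 1 + b + k + 2 * d = a + b + (k + 1) + 2 * d by ring] at h1
      refine h1.trans (le_of_eq ?_)
      ring
    have t3 : wt (Pi.single i b + 2) x * ‖(a : ℂ) * (pderiv i)^[a - 1] g x‖ ≤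
        Q * D ^ k * ρ ^ (a + b + 2 * d) * M.seq (a + b + (k + 1) + 2 * d) * (κ * m) := by
      rcases a with _ | a
      · simp only [Nat.cast_zero, zero_mul, norm_zero, mul_zero]
        positivity
      · have h1 := ih a b x
        rw [Nat.add_sub_cancel, norm_mul, Complex.norm_natCast]
        have h2 := hκM (a + b + k + 2 * d)
        rw [show a + b + k + 2 * d + 2 = a + 1 + b + (k + 1) + 2 * d by ring] at h2
        have p1 := M.seq_pos (a + b + k + 2 * d)
        calc wt (Pi.single i b + 2) x * (((a + 1 : ℕ) : ℝ) * ‖(pderiv i)^[a] g x‖)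
            = ((a + 1 : ℕ) : ℝ) * (wt (Pi.single i b + 2) x * ‖(pderiv i)^[a] g x‖) := by ring
          _ ≤ ((a + 1 : ℕ) : ℝ) *
              (Q * D ^ k * ρ ^ (a + b + 2 * d) * M.seq (a + b + k + 2 * d)) := by gcongr
          _ = Q * D ^ k * ρ ^ (a + b + 2 * d) *
              (((a + 1 : ℕ) : ℝ) * M.seq (a + b + k + 2 * d)) := by ring
          _ ≤ Q * D ^ k * ρ ^ (a + b + 2 * d) *
              (κ * M.seq (a + 1 + b + (k + 1) + 2 * d)) := by
              refine mul_le_mul_of_nonneg_left (le_trans ?_ h2) (by positivity)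
              gcongr
              push_cast
              have e1 : (0 : ℝ) ≤ b := Nat.cast_nonneg _
              have e2 : (0 : ℝ) ≤ k := Nat.cast_nonneg _
              have e3 : (0 : ℝ) ≤ d := Nat.cast_nonneg _
              linarith
          _ = Q * D ^ k * (ρ ^ (a + b + 2 * d) * (ρ * m)) *
              (κ * M.seq (a + 1 + b + (k + 1) + 2 * d)) := by
              rw [hρ, inv_mul_cancel₀ hm.ne', mul_one]
          _ = _ := by ring
    calc wt (Pi.single i b + 2) x * ‖(x i : ℂ) * (pderiv i)^[a] g x +
          a * (pderiv i)^[a - 1] g x + (pderiv i)^[a + 1] g x‖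
        ≤ wt (Pi.single i b + 2) x * (‖(x i : ℂ) * (pderiv i)^[a] g x‖ +
          ‖(a : ℂ) * (pderiv i)^[a - 1] g x‖ + ‖(pderiv i)^[a + 1] g x‖) := by
          gcongr
          exact norm_add₃_le
      _ ≤ Q * D ^ k * ρ ^ (a + b + 2 * d) * M.seq (a + b + (k + 1) + 2 * d) * ρ +
          Q * D ^ k * ρ ^ (a + b + 2 * d) * M.seq (a + b + (k + 1) + 2 * d) * (κ * m) +
          Q * D ^ k * ρ ^ (a + b + 2 * d) * M.seq (a + b + (k + 1) + 2 * d) * ρ := by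
          rw [mul_add, mul_add]
          exact add_le_add (add_le_add t1 t3) t2
      _ = _ := by
          rw [hD]
          ring

/-- The Hermite coefficient `∫ f h_n`. -/
noncomputable def coeff (n : Fin d → ℕ) (f : (Fin d → ℝ) → ℂ) : ℂ := ∫ x, f x * hermiteFun n x

lemma integrable_hermiteFun (n : Fin d → ℕ) : Integrable (hermiteFun n) :=
  (Integrable.fintype_prod (f := fun i => hermite₁ (n i))
    fun i => integrable_hermite₁ (n i)).ofReal

lemma integrable_mul_hermiteFun (n : Fin d → ℕ) {g : (Fin d → ℝ) → ℂ} (hg : Continuous g) {C : ℝ}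
    (hC : ∀ x, ‖g x‖ ≤ C) : Integrable fun x => g x * hermiteFun n x :=
  (integrable_hermiteFun n).bdd_mul hg.aestronglyMeasurable (Eventually.of_forall hC)

/-- Integration by parts: the raising operator `x_i - ∂_i` acting on `h_n` is the adjoint of
`x_i + ∂_i`. -/
lemma coeff_lower (n : Fin d → ℕ) (i : Fin d) {g : (Fin d → ℝ) → ℂ} (hg : ContDiff ℝ ∞ g)
    {C C' : ℝ} (hC : ∀ x, ‖g x‖ ≤ C) (hC' : ∀ x, ‖pderiv i g x‖ ≤ C') :
    coeff n (lower i g) =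
      (√(2 * ((n i : ℝ) + 1)) : ℂ) * coeff (Function.update n i (n i + 1)) g := by
  have hi := fun n => integrable_mul_hermiteFun n hg.continuous hC
  have hi' := integrable_mul_hermiteFun n (pderiv_contDiff i hg).continuous hC'
  have hxg : Integrable fun x : Fin d → ℝ => (x i : ℂ) * g x * hermiteFun n x := by
    refine (((hi (Function.update n i (n i - 1))).const_mul (√((n i : ℝ) / 2) : ℂ)).add
      ((hi (Function.update n i (n i + 1))).const_mul (√(((n i : ℝ) + 1) / 2) : ℂ))).congr
      (Eventually.of_forall fun x => ?_)
    simp only [Pi.add_apply]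
    linear_combination (-g x) * mul_hermiteFun n i x
  have hgd : Integrable fun x : Fin d → ℝ => g x *
      ((√((n i : ℝ) / 2) : ℂ) * hermiteFun (Function.update n i (n i - 1)) x -
        (√(((n i : ℝ) + 1) / 2) : ℂ) * hermiteFun (Function.update n i (n i + 1)) x) := by
    refine (((hi (Function.update n i (n i - 1))).const_mul (√((n i : ℝ) / 2) : ℂ)).sub
      ((hi (Function.update n i (n i + 1))).const_mul (√(((n i : ℝ) + 1) / 2) : ℂ))).congr
      (Eventually.of_forall fun x => ?_)
    simp only [Pi.sub_apply]
    ring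
  have hibp := integral_bilinear_hasLineDerivAt_right_eq_neg_left_of_integrable
    (μ := (volume : Measure (Fin d → ℝ))) (B := ContinuousLinearMap.mul ℝ ℂ) (f := g)
    (g := hermiteFun n) (v := Pi.single i 1) hi' hgd (hi n)
    (fun x _ => hasLineDerivAt_pderiv i hg x) (fun x _ => hasLineDerivAt_hermiteFun n i x)
  simp only [ContinuousLinearMap.mul_apply'] at hibp
  have h1 : coeff n (lower i g) = (∫ x : Fin d → ℝ, (x i : ℂ) * g x * hermiteFun n x) +
      ∫ x, pderiv i g x * hermiteFun n x := by
    rw [coeff, ← integral_add hxg hi']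
    congr 1 with x
    rw [lower, Pi.add_apply, add_mul]
  rw [h1, ← neg_eq_iff_eq_neg.2 hibp, ← sub_eq_add_neg, ← integral_sub hxg hgd, coeff,
    ← integral_const_mul]
  congr 1 with x
  rw [sqrt_two_mul]
  push_cast
  linear_combination (g x) * mul_hermiteFun n i x

lemma norm_coeff_mul_le (n : Fin d → ℕ) (i : Fin d) (k : ℕ) {g : (Fin d → ℝ) → ℂ}
    (hg : ContDiff ℝ ∞ g) (hC : ∀ k, ∃ C, ∀ x, ‖(lower i)^[k] g x‖ ≤ C)
    (hC' : ∀ k, ∃ C, ∀ x, ‖pderiv i ((lower i)^[k] g) x‖ ≤ C) :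
    √(2 * ((n i : ℝ) + 1)) ^ k * ‖coeff (Function.update n i (n i + k)) g‖ ≤
      ‖coeff n ((lower i)^[k] g)‖ := by
  induction k generalizing g with
  | zero => simp
  | succ k ih =>
    have h1 := ih (lower_contDiff i hg) (fun k => hC (k + 1)) (fun k => hC' (k + 1))
    obtain ⟨C, hC0⟩ := hC 0
    obtain ⟨C', hC0'⟩ := hC' 0
    refine le_trans ?_ h1
    rw [coeff_lower _ i hg hC0 hC0', norm_mul, Complex.norm_real,
      Real.norm_of_nonneg (Real.sqrt_nonneg _), Function.update_self, Function.update_idem,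
      pow_succ, mul_assoc, ← add_assoc]
    gcongr
    linarith [Nat.cast_nonneg (α := ℝ) k]

lemma integrable_inv_wt_two : Integrable fun x : Fin d → ℝ => (wt 2 x)⁻¹ := by
  refine (Integrable.fintype_prod (f := fun (_ : Fin d) (t : ℝ) => (1 + t ^ 2)⁻¹)
    fun _ => integrable_inv_one_add_sq).congr (Eventually.of_forall fun x => ?_)
  simp only [wt, Finset.prod_inv_distrib]
  congr 1
  refine Finset.prod_congr rfl fun i _ => ?_
  norm_num

lemma norm_coeff_le (n : Fin d → ℕ) {g : (Fin d → ℝ) → ℂ} {C : ℝ}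
    (hC : ∀ x, wt 2 x * ‖g x‖ ≤ C) :
    ‖coeff n g‖ ≤ C * ((len n : ℝ) + 2) ^ d * ∫ x : Fin d → ℝ, (wt 2 x)⁻¹ := by
  rw [← integral_const_mul]
  refine norm_integral_le_of_norm_le (integrable_inv_wt_two.const_mul _)
    (Eventually.of_forall fun x => ?_)
  have hw : 0 < wt 2 x := one_pos.trans_le (one_le_wt 2 x)
  have h1 : ‖g x‖ ≤ C * (wt 2 x)⁻¹ := by
    rw [← div_eq_mul_inv, le_div_iff₀' hw]
    exact hC x
  rw [norm_mul]
  calc ‖g x‖ * ‖hermiteFun n x‖ ≤ C * (wt 2 x)⁻¹ * ((len n : ℝ) + 2) ^ d :=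
        mul_le_mul h1 (norm_hermiteFun_le n x) (norm_nonneg _) ((norm_nonneg _).trans h1)
    _ = _ := by ring

lemma NormLE.wt_mul_norm_le {M : WeightSequence} {m Q : ℝ} (hm : 0 < m) {f : (Fin d → ℝ) → ℂ}
    (h : NormLE M m Q f) (β : Fin d → ℕ) (x : Fin d → ℝ) :
    wt β x * ‖f x‖ ≤ Q * (m⁻¹ ^ len β * M.seq (len β)) := by
  have h1 := h 0 β x
  have h0 : len (0 : Fin d → ℕ) = 0 := by simp [len]
  have p2 := M.seq_pos (len β)
  rw [term, mderiv_zero, h0, M.seq_zero, zero_add, one_mul, div_mul_eq_mul_div,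
    div_le_iff₀ p2, ← le_div_iff₀' (pow_pos hm _)] at h1
  refine h1.trans (le_of_eq ?_)
  rw [inv_pow]
  ring

lemma exists_norm_coeff_le (M : WeightSequence) {m : ℝ} (hm : 0 < m) (d : ℕ) :
    ∃ C : ℝ, 0 < C ∧ ∀ {f : (Fin d → ℝ) → ℂ} {Q : ℝ}, NormLE M m Q f →
      ∀ n, ‖coeff n f‖ ≤ C * Q * ((len n : ℝ) + 2) ^ d := by
  set I := ∫ x : Fin d → ℝ, (wt 2 x)⁻¹ with hI
  have hI0 : 0 ≤ I := integral_nonneg fun x => inv_nonneg.2 (wt_nonneg 2 x)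
  have hp := M.seq_pos (len (2 : Fin d → ℕ))
  refine ⟨m⁻¹ ^ len (2 : Fin d → ℕ) * M.seq (len (2 : Fin d → ℕ)) * (I + 1),
    by positivity, fun {f Q} h n => ?_⟩
  have hQ := h.nonneg
  refine (norm_coeff_le n (h.wt_mul_norm_le hm 2)).trans ?_
  rw [← hI]
  calc _ ≤ Q * (m⁻¹ ^ len (2 : Fin d → ℕ) * M.seq (len (2 : Fin d → ℕ))) *
        ((len n : ℝ) + 2) ^ d * (I + 1) := by
        gcongr
        linarith
    _ = _ := by ring

lemma exists_norm_coeff_mul_sqrt_pow_le (M : WeightSequence) {m : ℝ} (hm : 0 < m) (d : ℕ) :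
    ∃ C D : ℝ, 0 < C ∧ 0 < D ∧ ∀ {f : (Fin d → ℝ) → ℂ} {Q : ℝ}, ContDiff ℝ ∞ f →
      NormLE M m Q f → ∀ (n : Fin d → ℕ) (i : Fin d) (k : ℕ), 2 * k ≤ n i →
        ‖coeff n f‖ * √(n i : ℝ) ^ k ≤ C * Q * ((len n : ℝ) + 2) ^ d * (D ^ k * M.seq k) := by
  obtain ⟨A, H, hA, hH, hAH⟩ := M.stable
  obtain ⟨D, hD, h⟩ := exists_iterate_lower_le M hm
  set I := ∫ x : Fin d → ℝ, (wt 2 x)⁻¹ with hI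
  have hI0 : 0 ≤ I := integral_nonneg fun x => inv_nonneg.2 (wt_nonneg 2 x)
  have hp := M.seq_pos (2 * d)
  refine ⟨m⁻¹ ^ (2 * d) * (A * H ^ (2 * d) * M.seq (2 * d)) * (I + 1), D * H,
    by positivity, by positivity, fun {f Q} hf hQ n i k hk => ?_⟩
  have hQ0 := hQ.nonneg
  have hk0 := M.seq_pos k
  -- start the iteration of `coeff_lower` from the index `n_i - k ≥ n_i / 2`
  set n' := Function.update n i (n i - k) with hn'
  have hn'i : n' i = n i - k := Function.update_self ..
  have hup : Function.update n' i (n' i + k) = n := by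
    rw [hn'i, hn', Function.update_idem, Nat.sub_add_cancel (by omega), Function.update_eq_self]
  have hbase : ∀ j a x, ‖(pderiv i)^[a] ((lower i)^[j] f) x‖ ≤
      Q * D ^ j * m⁻¹ ^ (a + 0 + 2 * d) * M.seq (a + 0 + j + 2 * d) := fun j a x =>
    (le_mul_of_one_le_left (norm_nonneg _) (one_le_wt _ x)).trans (h hf hQ i j a 0 x)
  have h1 := norm_coeff_mul_le n' i k hf (fun j => ⟨_, hbase j 0⟩) (fun j => ⟨_, hbase j 1⟩)
  rw [hup] at h1
  have h2 : ∀ x, wt 2 x * ‖(lower i)^[k] f x‖ ≤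
      Q * D ^ k * m⁻¹ ^ (0 + 0 + 2 * d) * M.seq (0 + 0 + k + 2 * d) := fun x => by
    have := h hf hQ i k 0 0 x
    rwa [Pi.single_zero, zero_add] at this
  have h3 := norm_coeff_le n' h2
  have h4 : M.seq (0 + 0 + k + 2 * d) ≤ A * H ^ (k + 2 * d) * (M.seq k * M.seq (2 * d)) := by
    have := hAH (k + 2 * d) k (by omega)
    rw [Nat.add_sub_cancel_left] at this
    simpa using this
  have h5 : (len n' : ℝ) ≤ len n := by
    have : len n' ≤ len n := by
      refine Finset.sum_le_sum fun j _ => ?_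
      rw [hn']
      by_cases hj : j = i
      · subst hj; simp
      · simp [hj]
    exact_mod_cast this
  have h6 : √(n i : ℝ) ^ k ≤ √(2 * ((n' i : ℝ) + 1)) ^ k := by
    gcongr
    have : n i ≤ 2 * (n' i + 1) := by omega
    exact_mod_cast this
  calc ‖coeff n f‖ * √(n i : ℝ) ^ k ≤ √(2 * ((n' i : ℝ) + 1)) ^ k * ‖coeff n f‖ := by
        rw [mul_comm]
        gcongr
    _ ≤ Q * D ^ k * m⁻¹ ^ (0 + 0 + 2 * d) * M.seq (0 + 0 + k + 2 * d) *
        ((len n' : ℝ) + 2) ^ d * I := h1.trans h3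
    _ ≤ Q * D ^ k * m⁻¹ ^ (0 + 0 + 2 * d) * (A * H ^ (k + 2 * d) * (M.seq k * M.seq (2 * d))) *
        ((len n : ℝ) + 2) ^ d * (I + 1) := by
        gcongr
        linarith
    _ = _ := by
        rw [zero_add, zero_add, pow_add, mul_pow]
        ring

end coefficients

/-! ### Absolute convergence of Hermite expansions -/

section expansion

variable {d : ℕ}

/-- A summable family on the multi-indices, which dominates the terms of all Hermite expansions. -/
noncomputable def decay (n : Fin d → ℕ) : ℝ := ∏ i, (((n i : ℝ) + 1) ^ 2)⁻¹

lemma decay_nonneg (n : Fin d → ℕ) : 0 ≤ decay n :=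
  Finset.prod_nonneg fun _ _ => by positivity

lemma summable_prod_of_nonneg {a : ℕ → ℝ} (ha : ∀ k, 0 ≤ a k) (hs : Summable a) :
    Summable fun n : Fin d → ℕ => ∏ i, a (n i) := by
  have h0 : ∀ n : Fin d → ℕ, 0 ≤ ∏ i, a (n i) := fun n => Finset.prod_nonneg fun i _ => ha _
  refine summable_of_sum_le (c := (∑' k, a k) ^ d) h0 fun s => ?_
  have hsub : s ⊆ Fintype.piFinset fun i => s.image fun n => n i := fun n hn =>
    Fintype.mem_piFinset.2 fun i => Finset.mem_image_of_mem (fun n : Fin d → ℕ => n i) hn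
  refine (Finset.sum_le_sum_of_subset_of_nonneg hsub fun n _ _ => h0 n).trans ?_
  rw [← Finset.prod_univ_sum (fun i => s.image fun n => n i) fun _ k => a k]
  refine (Finset.prod_le_prod (g := fun _ => ∑' k, a k)
    (fun i _ => Finset.sum_nonneg fun k _ => ha k)
    fun i _ => hs.sum_le_tsum _ fun k _ => ha k).trans (le_of_eq ?_)
  rw [Finset.prod_const, Finset.card_univ, Fintype.card_fin]

lemma summable_decay : Summable (decay : (Fin d → ℕ) → ℝ) := by
  refine summable_prod_of_nonneg (a := fun k : ℕ => (((k : ℝ) + 1) ^ 2)⁻¹)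
    (fun k => by positivity) ?_
  have := (summable_nat_add_iff 1).2 (Real.summable_nat_pow_inv.2 one_lt_two)
  simpa using this

lemma inv_pow_le_decay (n : Fin d → ℕ) {N : ℕ} (hN : ∀ i, n i ≤ N) :
    (((N : ℝ) + 1) ^ (2 * d))⁻¹ ≤ decay n := by
  have h1 : (((N : ℝ) + 1) ^ (2 * d))⁻¹ = ∏ _i : Fin d, (((N : ℝ) + 1) ^ 2)⁻¹ := by
    simp [pow_mul]
  rw [h1]
  refine Finset.prod_le_prod (fun _ _ => by positivity) fun i _ => ?_
  have : (n i : ℝ) ≤ N := by exact_mod_cast hN i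
  gcongr

lemma exists_succ_pow_le (j : ℕ) : ∃ E : ℝ, 0 < E ∧ ∀ p : ℕ, ((p : ℝ) + 1) ^ j ≤ E * 3 ^ p := by
  refine ⟨j.factorial * 3, by positivity, fun p => ?_⟩
  have h1 := Real.pow_div_factorial_le_exp ((p : ℝ) + 1) (by positivity) j
  rw [div_le_iff₀' (by positivity)] at h1
  have h2 : Real.exp 1 ≤ 3 := Real.exp_one_lt_d9.le.trans (by norm_num)
  have h3 : Real.exp ((p : ℝ) + 1) ≤ 3 ^ (p + 1) := by
    have : Real.exp ((p : ℝ) + 1) = Real.exp 1 ^ (p + 1) := by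
      rw [← Real.exp_nat_mul]
      push_cast
      ring_nf
    rw [this]
    gcongr
  calc ((p : ℝ) + 1) ^ j ≤ j.factorial * Real.exp ((p : ℝ) + 1) := h1
    _ ≤ j.factorial * 3 ^ (p + 1) := by gcongr
    _ = _ := by ring

/-- The product of the decay of a coefficient of modulus `c` and of the growth of the Hermite
function of degree `L`, for `p = |α| + |β|` small compared with the largest index `N`: the choice
`k = p + 8d` in the decay estimate compensates the growth `(L + p)^{p/2}` and leaves a negative
power of `N`. -/
lemma exists_bound_of_le (M : WeightSequence) (d : ℕ) {D : ℝ} (hD : 0 < D) :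
    ∃ μ E : ℝ, 0 < μ ∧ 0 < E ∧ ∀ (c R : ℝ) (N L p : ℕ), 0 ≤ R → 0 ≤ c → L ≤ d * N →
      2 * (p + 8 * d) ≤ N →
      (∀ k : ℕ, 2 * k ≤ N → c * √(N : ℝ) ^ k ≤ R * ((L : ℝ) + 2) ^ d * (D ^ k * M.seq k)) →
      ∀ m : ℝ, 0 ≤ m → m ≤ μ →
        c * (m ^ p * ((3 * √((L : ℝ) + p)) ^ p * ((L : ℝ) + p + 2) ^ d)) ≤
          E * R * M.seq p * (((N : ℝ) + 1) ^ (2 * d))⁻¹ := by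
  obtain ⟨A, H, hA, hH, hAH⟩ := M.stable
  have hr := M.seq_pos (8 * d)
  refine ⟨(3 * D * H * √((d : ℝ) + 1))⁻¹,
    A * M.seq (8 * d) * (D * H) ^ (8 * d) * ((d : ℝ) + 3) ^ (2 * d) * 2 ^ (4 * d),
    by positivity, by positivity, ?_⟩
  intro c R N L p hR hc hL hp hk m hm hmμ
  have hMp := M.seq_pos p
  have hMp' := M.seq_pos (p + 8 * d)
  have hLr : (L : ℝ) ≤ d * N := by exact_mod_cast hL
  have hpN : (p : ℝ) ≤ N := by exact_mod_cast (by omega : p ≤ N)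
  have h1 := hk (p + 8 * d) hp
  have h2 : M.seq (p + 8 * d) ≤ A * H ^ (p + 8 * d) * (M.seq p * M.seq (8 * d)) := by
    have := hAH (p + 8 * d) p (by omega)
    rwa [Nat.add_sub_cancel_left] at this
  have hsq : √(N : ℝ) ^ (p + 8 * d) = √(N : ℝ) ^ p * (N : ℝ) ^ (4 * d) := by
    rw [pow_add, show 8 * d = 2 * (4 * d) by ring, pow_mul _ 2, Real.sq_sqrt (Nat.cast_nonneg N)]
  rw [hsq] at h1
  have hN2 : ((N : ℝ) + 1) ^ (4 * d) ≤ 2 ^ (4 * d) * (N : ℝ) ^ (4 * d) := by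
    rcases Nat.eq_zero_or_pos d with rfl | hd
    · simp
    · rw [← mul_pow]
      have : (1 : ℝ) ≤ N := by exact_mod_cast (by omega : 1 ≤ N)
      gcongr
      linarith
  have hs1 : √((L : ℝ) + p) ≤ √((d : ℝ) + 1) * √(N : ℝ) := by
    rw [← Real.sqrt_mul (by positivity)]
    apply Real.sqrt_le_sqrt
    linarith
  have hpoly : ((L : ℝ) + p + 2) ≤ ((d : ℝ) + 3) * ((N : ℝ) + 1) := by
    have : (0 : ℝ) ≤ d := Nat.cast_nonneg d
    nlinarith
  have hpoly' : ((L : ℝ) + 2) ≤ ((d : ℝ) + 3) * ((N : ℝ) + 1) := by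
    have : (0 : ℝ) ≤ p := Nat.cast_nonneg p
    linarith
  have hbase : 3 * D * H * √((d : ℝ) + 1) * m ≤ 1 := by
    have hpos : 0 < 3 * D * H * √((d : ℝ) + 1) := by positivity
    calc _ ≤ 3 * D * H * √((d : ℝ) + 1) * (3 * D * H * √((d : ℝ) + 1))⁻¹ := by gcongr
      _ = 1 := mul_inv_cancel₀ hpos.ne'
  rw [← div_eq_mul_inv, le_div_iff₀ (by positivity)]
  calc c * (m ^ p * ((3 * √((L : ℝ) + p)) ^ p * ((L : ℝ) + p + 2) ^ d)) * ((N : ℝ) + 1) ^ (2 * d)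
      ≤ c * (m ^ p * ((3 * (√((d : ℝ) + 1) * √(N : ℝ))) ^ p *
        (((d : ℝ) + 3) * ((N : ℝ) + 1)) ^ d)) * ((N : ℝ) + 1) ^ (2 * d) := by gcongr
    _ = c * √(N : ℝ) ^ p * (m ^ p * (3 * √((d : ℝ) + 1)) ^ p * ((d : ℝ) + 3) ^ d *
        ((N : ℝ) + 1) ^ (3 * d)) := by
        rw [show 3 * d = d + 2 * d by ring, pow_add]
        simp only [mul_pow]
        ring
    _ ≤ (A * M.seq (8 * d) * (D * H) ^ (8 * d) * ((d : ℝ) + 3) ^ (2 * d) * 2 ^ (4 * d)) * R *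
        M.seq p * (3 * D * H * √((d : ℝ) + 1) * m) ^ p := by
        rcases (by positivity : (0 : ℝ) ≤ (N : ℝ) ^ (4 * d)).eq_or_lt with h0 | hNpos
        · -- `N = 0` and `d > 0` is excluded
          exfalso
          rw [← h0, mul_zero] at hN2
          exact absurd hN2 (not_le.2 (by positivity))
        refine le_of_mul_le_mul_right ?_ hNpos
        calc c * √(N : ℝ) ^ p * (m ^ p * (3 * √((d : ℝ) + 1)) ^ p * ((d : ℝ) + 3) ^ d *
              ((N : ℝ) + 1) ^ (3 * d)) * (N : ℝ) ^ (4 * d)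
            = c * (√(N : ℝ) ^ p * (N : ℝ) ^ (4 * d)) * (m ^ p * (3 * √((d : ℝ) + 1)) ^ p *
              ((d : ℝ) + 3) ^ d * ((N : ℝ) + 1) ^ (3 * d)) := by ring
          _ ≤ R * (((d : ℝ) + 3) * ((N : ℝ) + 1)) ^ d * (D ^ (p + 8 * d) *
              (A * H ^ (p + 8 * d) * (M.seq p * M.seq (8 * d)))) *
              (m ^ p * (3 * √((d : ℝ) + 1)) ^ p * ((d : ℝ) + 3) ^ d *
                ((N : ℝ) + 1) ^ (3 * d)) := by
              refine mul_le_mul_of_nonneg_right (h1.trans ?_) (by positivity)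
              gcongr
          _ = (A * M.seq (8 * d) * (D * H) ^ (8 * d) * ((d : ℝ) + 3) ^ (2 * d)) * R * M.seq p *
              (3 * D * H * √((d : ℝ) + 1) * m) ^ p * ((N : ℝ) + 1) ^ (4 * d) := by
              rw [show 4 * d = d + 3 * d by ring, show 2 * d = d + d by ring]
              simp only [mul_pow, pow_add]
              ring
          _ ≤ (A * M.seq (8 * d) * (D * H) ^ (8 * d) * ((d : ℝ) + 3) ^ (2 * d)) * R * M.seq p *
              (3 * D * H * √((d : ℝ) + 1) * m) ^ p * (2 ^ (4 * d) * (N : ℝ) ^ (4 * d)) := by gcongr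
          _ = _ := by ring
    _ ≤ (A * M.seq (8 * d) * (D * H) ^ (8 * d) * ((d : ℝ) + 3) ^ (2 * d) * 2 ^ (4 * d)) * R *
        M.seq p * 1 := by
        refine mul_le_mul_of_nonneg_left (pow_le_one₀ (by positivity) hbase) (by positivity)
    _ = _ := by ring

/-- The same for `p` large: then the growth of the Hermite function is controlled by (M.3)'' alone,
and the geometric decay in `p` beats all powers of `N`. -/
lemma exists_bound_of_lt (M : WeightSequence) (d r : ℕ) :
    ∃ μ E : ℝ, 0 < μ ∧ 0 < E ∧ ∀ (c R : ℝ) (N L p : ℕ), 0 ≤ R → 0 ≤ c → L ≤ d * N →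
      N ≤ 2 * (p + r) → c ≤ R * ((L : ℝ) + 2) ^ d → ∀ m : ℝ, 0 ≤ m → m ≤ μ →
        c * (m ^ p * ((3 * √((L : ℝ) + p)) ^ p * ((L : ℝ) + p + 2) ^ d)) ≤
          E * R * M.seq p * (((N : ℝ) + 1) ^ (2 * d))⁻¹ := by
  obtain ⟨C, L₀, hC, hL₀, hCL⟩ := M.sqrt_pow_le
  obtain ⟨E, hE, hEp⟩ := exists_succ_pow_le (4 * d)
  have hC0 : 0 < C := one_pos.trans_le hC
  set B : ℝ := 2 * ((d : ℝ) + 1) * (r + 1) + 2 with hB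
  have hB0 : 0 < B := by positivity
  refine ⟨(9 * √B * L₀)⁻¹, C * B ^ (4 * d) * E, by positivity, by positivity, ?_⟩
  intro c R N L p hR hc hL hp hcR m hm hmμ
  have hMp := M.seq_pos p
  have hd0 : (0 : ℝ) ≤ d := Nat.cast_nonneg d
  have hp0 : (0 : ℝ) ≤ p := Nat.cast_nonneg p
  have hLr : (L : ℝ) ≤ d * N := by exact_mod_cast hL
  have hNr : (N : ℝ) ≤ 2 * (p + r) := by exact_mod_cast hp
  have hLr' : (L : ℝ) ≤ d * (2 * (p + r)) := hLr.trans (by gcongr)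
  have hr0 : (0 : ℝ) ≤ r := Nat.cast_nonneg r
  have hdp : 0 ≤ (d : ℝ) * p := by positivity
  have hrp : 0 ≤ (r : ℝ) * p := by positivity
  have hdrp : 0 ≤ (d : ℝ) * r * p := by positivity
  have hpoly : (L : ℝ) + p + 2 ≤ B * ((p : ℝ) + 1) := by
    rw [hB]
    nlinarith
  have hpoly' : (L : ℝ) + 2 ≤ B * ((p : ℝ) + 1) := by linarith
  have hNB : (N : ℝ) + 1 ≤ B * ((p : ℝ) + 1) := by
    rw [hB]
    nlinarith
  have hsq : √((L : ℝ) + p) ^ p ≤ √B ^ p * (C * L₀ ^ p * M.seq p) := by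
    rcases Nat.eq_zero_or_pos p with rfl | hp1
    · simp only [pow_zero, one_mul, M.seq_zero, mul_one]
      exact hC
    · have hp1' : (1 : ℝ) ≤ p := by exact_mod_cast hp1
      have hle : (L : ℝ) + p ≤ B * p := by
        rw [hB]
        nlinarith [mul_nonneg (mul_nonneg hd0 hr0) (sub_nonneg.2 hp1')]
      calc √((L : ℝ) + p) ^ p ≤ (√B * √(p : ℝ)) ^ p := by
            rw [← Real.sqrt_mul hB0.le]
            gcongr
        _ = √B ^ p * √(p : ℝ) ^ p := mul_pow _ _ _
        _ ≤ _ := by gcongr; exact hCL p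
  have hbase : 9 * √B * L₀ * m ≤ 1 := by
    have hpos : 0 < 9 * √B * L₀ := by positivity
    calc _ ≤ 9 * √B * L₀ * (9 * √B * L₀)⁻¹ := by gcongr
      _ = 1 := mul_inv_cancel₀ hpos.ne'
  rw [← div_eq_mul_inv, le_div_iff₀ (by positivity)]
  calc c * (m ^ p * ((3 * √((L : ℝ) + p)) ^ p * ((L : ℝ) + p + 2) ^ d)) * ((N : ℝ) + 1) ^ (2 * d)
      = c * (m ^ p * (3 ^ p * √((L : ℝ) + p) ^ p * ((L : ℝ) + p + 2) ^ d)) *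
        ((N : ℝ) + 1) ^ (2 * d) := by rw [mul_pow]
    _ ≤ (R * (B * ((p : ℝ) + 1)) ^ d) * (m ^ p * (3 ^ p * (√B ^ p * (C * L₀ ^ p * M.seq p)) *
        (B * ((p : ℝ) + 1)) ^ d)) * (B * ((p : ℝ) + 1)) ^ (2 * d) := by
        have hc' : c ≤ R * (B * ((p : ℝ) + 1)) ^ d := hcR.trans (by gcongr)
        gcongr
    _ = R * C * M.seq p * B ^ (4 * d) * ((3 * √B * L₀ * m) ^ p * ((p : ℝ) + 1) ^ (4 * d)) := by
        rw [show 4 * d = d + d + 2 * d by ring]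
        simp only [mul_pow, pow_add]
        ring
    _ ≤ R * C * M.seq p * B ^ (4 * d) * ((3 * √B * L₀ * m) ^ p * (E * 3 ^ p)) := by
        gcongr
        exact hEp p
    _ = R * C * M.seq p * B ^ (4 * d) * E * (9 * √B * L₀ * m) ^ p := by
        rw [show 9 * √B * L₀ * m = 3 * √B * L₀ * m * 3 by ring, mul_pow _ (3 : ℝ) p]
        ring
    _ ≤ R * C * M.seq p * B ^ (4 * d) * E * 1 := by
        refine mul_le_mul_of_nonneg_left (pow_le_one₀ (by positivity) hbase) (by positivity)
    _ = _ := by ring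

/-- The weighted sup-norms of the Hermite functions, with (M.2) used to separate `m` from the
weights. -/
lemma exists_term_hermiteFun_le (M : WeightSequence) (d : ℕ) : ∃ A H : ℝ, 0 < A ∧ 0 < H ∧
    ∀ (n : Fin d → ℕ) (m : ℝ), 0 ≤ m → ∀ α β x, term M (m / H) (hermiteFun n) α β x ≤
      A / M.seq (len α + len β) * (m ^ (len α + len β) *
        ((3 * √((len n : ℝ) + (len α + len β : ℕ))) ^ (len α + len β) *
          ((len n : ℝ) + (len α + len β : ℕ) + 2) ^ d)) := by
  obtain ⟨A, H, hA, hH, hAH⟩ := M.stable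
  refine ⟨A, H, hA, hH, fun n m hm α β x => ?_⟩
  have hgrow := wt_mul_norm_mderiv_hermiteFun_le n α β x
  have hMM : M.seq (len α + len β) ≤
      A * H ^ (len α + len β) * (M.seq (len α) * M.seq (len β)) := by
    have := hAH (len α + len β) (len α) (by omega)
    rwa [Nat.add_sub_cancel_left] at this
  have p1 := M.seq_pos (len α)
  have p2 := M.seq_pos (len β)
  have p3 := M.seq_pos (len α + len β)
  rw [term, ← mul_assoc (A / M.seq (len α + len β))]
  refine mul_le_mul ?_ hgrow (mul_nonneg (wt_nonneg _ _) (norm_nonneg _)) (by positivity)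
  rw [div_mul_eq_mul_div, div_pow, div_div, div_le_div_iff₀ (by positivity) p3]
  calc m ^ (len α + len β) * M.seq (len α + len β)
      ≤ m ^ (len α + len β) *
        (A * H ^ (len α + len β) * (M.seq (len α) * M.seq (len β))) := by gcongr
    _ = _ := by ring

/-- Hermite functions belong to `S^{M_p}`. -/
lemma exists_normLE_hermiteFun (M : WeightSequence) (n : Fin d → ℕ) :
    ∃ m Q : ℝ, 0 < m ∧ NormLE M m Q (hermiteFun n) := by
  obtain ⟨A, H, hA, hH, hAH⟩ := exists_term_hermiteFun_le M d
  set N := Finset.univ.sup n with hN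
  obtain ⟨μ, E, hμ, hE, h⟩ := exists_bound_of_lt M d N
  have hLN : len n ≤ d * N := by
    calc len n ≤ ∑ _i : Fin d, N := Finset.sum_le_sum fun i _ => Finset.le_sup (Finset.mem_univ i)
      _ = d * N := by simp
  have h1 : (1 : ℝ) ≤ 1 * ((len n : ℝ) + 2) ^ d := by
    rw [one_mul]
    exact one_le_pow₀ (by linarith [Nat.cast_nonneg (α := ℝ) (len n)])
  refine ⟨μ / H, A * E * (((N : ℝ) + 1) ^ (2 * d))⁻¹, by positivity, fun α β x => ?_⟩
  have p3 := M.seq_pos (len α + len β)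
  have h2 := h 1 1 N (len n) (len α + len β) zero_le_one zero_le_one hLN (by omega) h1 μ
    hμ.le le_rfl
  rw [one_mul] at h2
  calc _ ≤ _ := hAH n μ hμ.le α β x
    _ ≤ A / M.seq (len α + len β) *
        (E * 1 * M.seq (len α + len β) * (((N : ℝ) + 1) ^ (2 * d))⁻¹) := by gcongr
    _ = _ := by field_simp

/-- The Hermite expansion of a function of `S^{M_p,m}` converges absolutely in `S^{M_p,m'}` for
some smaller `m'`. -/
theorem exists_normLE_coeff_smul (M : WeightSequence) {m : ℝ} (hm : 0 < m) (d : ℕ) :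
    ∃ m' C : ℝ, 0 < m' ∧ 0 ≤ C ∧ ∀ {f : (Fin d → ℝ) → ℂ} {Q : ℝ}, ContDiff ℝ ∞ f →
      NormLE M m Q f → ∀ n, NormLE M m' (C * Q * decay n) (coeff n f • hermiteFun n) := by
  obtain ⟨A, H, hA, hH, hAH⟩ := exists_term_hermiteFun_le M d
  obtain ⟨C₀, hC₀, hcoeff₀⟩ := exists_norm_coeff_le M hm d
  obtain ⟨C₁, D, hC₁, hD, hcoeff₁⟩ := exists_norm_coeff_mul_sqrt_pow_le M hm d
  obtain ⟨μ₁, E₁, hμ₁, hE₁, hle⟩ := exists_bound_of_le M d hD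
  obtain ⟨μ₂, E₂, hμ₂, hE₂, hlt⟩ := exists_bound_of_lt M d (8 * d)
  have hμ : 0 < min μ₁ μ₂ := lt_min hμ₁ hμ₂
  refine ⟨min μ₁ μ₂ / H, A * ((E₁ + E₂) * (C₀ + C₁)), by positivity, by positivity, ?_⟩
  intro f Q hf hQ n α β x
  have hQ0 := hQ.nonneg
  set p := len α + len β with hp
  set c := ‖coeff n f‖ with hc
  set N := Finset.univ.sup n with hN
  have hnN : ∀ i, n i ≤ N := fun i => Finset.le_sup (Finset.mem_univ i)
  have hLN : len n ≤ d * N := by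
    calc len n ≤ ∑ _i : Fin d, N := Finset.sum_le_sum fun i _ => hnN i
      _ = d * N := by simp
  set R := (C₀ + C₁) * Q with hR
  have hR0 : 0 ≤ R := by positivity
  have htriv : c ≤ R * ((len n : ℝ) + 2) ^ d := by
    refine (hcoeff₀ hQ n).trans ?_
    rw [hR]
    gcongr
    linarith
  have hk : ∀ k : ℕ, 2 * k ≤ N →
      c * √(N : ℝ) ^ k ≤ R * ((len n : ℝ) + 2) ^ d * (D ^ k * M.seq k) := by
    intro k hkN
    rcases Nat.eq_zero_or_pos k with rfl | hkpos
    · simpa [M.seq_zero] using htriv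
    · -- `N > 0`, so that the maximum is attained
      have hne : (Finset.univ : Finset (Fin d)).Nonempty := by
        by_contra h
        rw [Finset.not_nonempty_iff_eq_empty] at h
        rw [hN, h, Finset.sup_empty] at hkN
        simp at hkN
        omega
      obtain ⟨i, -, hi⟩ := Finset.exists_mem_eq_sup _ hne n
      have h1 := hcoeff₁ hf hQ n i k (by rw [← hi]; exact hkN)
      rw [← hi] at h1
      refine h1.trans ?_
      have := M.seq_pos k
      rw [hR]
      gcongr
      linarith
  have hbound : c * (min μ₁ μ₂ ^ p * ((3 * √((len n : ℝ) + p)) ^ p * ((len n : ℝ) + p + 2) ^ d)) ≤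
      (E₁ + E₂) * R * M.seq p * (((N : ℝ) + 1) ^ (2 * d))⁻¹ := by
    have hMp := M.seq_pos p
    rcases le_or_gt (2 * (p + 8 * d)) N with h | h
    · refine (hle c R N (len n) p hR0 (norm_nonneg _) hLN h hk _ hμ.le (min_le_left _ _)).trans ?_
      gcongr
      linarith
    · refine (hlt c R N (len n) p hR0 (norm_nonneg _) hLN h.le htriv _ hμ.le
        (min_le_right _ _)).trans ?_
      gcongr
      linarith
  have p3 := M.seq_pos p
  rw [term_smul M _ _ (contDiff_hermiteFun n), ← hc]
  calc c * term M (min μ₁ μ₂ / H) (hermiteFun n) α β x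
      ≤ c * (A / M.seq p * (min μ₁ μ₂ ^ p *
        ((3 * √((len n : ℝ) + p)) ^ p * ((len n : ℝ) + p + 2) ^ d))) :=
        mul_le_mul_of_nonneg_left (hAH n _ hμ.le α β x) (norm_nonneg _)
    _ = A / M.seq p * (c * (min μ₁ μ₂ ^ p *
        ((3 * √((len n : ℝ) + p)) ^ p * ((len n : ℝ) + p + 2) ^ d))) := by ring
    _ ≤ A / M.seq p * ((E₁ + E₂) * R * M.seq p * (((N : ℝ) + 1) ^ (2 * d))⁻¹) := by gcongr
    _ = A * ((E₁ + E₂) * (C₀ + C₁)) * Q * (((N : ℝ) + 1) ^ (2 * d))⁻¹ := by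
        rw [hR]
        field_simp
    _ ≤ _ := by
        gcongr
        exact inv_pow_le_decay n hnN

end expansion

/-! ### Completeness of the Hermite functions -/

section completeness

open MeasureTheory

variable {d : ℕ}

/-- The pairing `ξ · x`. -/
def pairing (ξ x : Fin d → ℝ) : ℝ := ∑ i, ξ i * x i

lemma continuous_pairing (ξ : Fin d → ℝ) : Continuous (pairing ξ) := by
  unfold pairing
  fun_prop

lemma integrable_exp_pairing_mul (ξ : Fin d → ℝ) (n : Fin d → ℕ) :
    Integrable fun x => Real.exp |pairing ξ x| * ‖hermiteFun n x‖ := by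
  refine Integrable.mono' (Integrable.fintype_prod
    (f := fun i t => Real.exp (|ξ i| * |t|) * |hermite₁ (n i) t|)
    fun i => integrable_exp_mul_hermite₁ (n i) |ξ i|) ?_ (Eventually.of_forall fun x => ?_)
  · have h1 := continuous_pairing ξ
    have h2 := (contDiff_hermiteFun n).continuous
    exact Continuous.aestronglyMeasurable (by fun_prop)
  · rw [Real.norm_of_nonneg (by positivity), Finset.prod_mul_distrib, hermiteFun,
      Complex.norm_real, Real.norm_eq_abs, Finset.abs_prod, ← Real.exp_sum]
    gcongr
    refine (Finset.abs_sum_le_sum_abs _ _).trans (le_of_eq ?_)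
    simp only [abs_mul]

lemma integrable_mul_pairing_pow_mul (ξ : Fin d → ℝ) (n : Fin d → ℕ) (k : ℕ)
    {g : (Fin d → ℝ) → ℂ} (hg : Continuous g) {C : ℝ} (hC : ∀ x, ‖g x‖ ≤ C) :
    Integrable fun x => g x * (pairing ξ x : ℂ) ^ k * hermiteFun n x := by
  have h1 := continuous_pairing ξ
  have h2 := (contDiff_hermiteFun n).continuous
  refine Integrable.mono' ((integrable_exp_pairing_mul ξ n).const_mul (C * k.factorial))
    (Continuous.aestronglyMeasurable (by fun_prop)) (Eventually.of_forall fun x => ?_)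
  have h3 := Real.pow_div_factorial_le_exp |pairing ξ x| (abs_nonneg _) k
  rw [div_le_iff₀' (by positivity)] at h3
  rw [norm_mul, norm_mul, norm_pow, Complex.norm_real, Real.norm_eq_abs]
  have hC0 : 0 ≤ C := (norm_nonneg _).trans (hC 0)
  calc ‖g x‖ * |pairing ξ x| ^ k * ‖hermiteFun n x‖
      ≤ C * (k.factorial * Real.exp |pairing ξ x|) * ‖hermiteFun n x‖ := by
        gcongr
        exact hC x
    _ = _ := by ring

/-- Polynomials times Hermite functions are linear combinations of Hermite functions. -/
lemma integral_mul_pairing_pow_mul_eq_zero {g : (Fin d → ℝ) → ℂ} (hg : Continuous g) {C : ℝ}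
    (hC : ∀ x, ‖g x‖ ≤ C) (h0 : ∀ n, coeff n g = 0) (ξ : Fin d → ℝ) (k : ℕ) (n : Fin d → ℕ) :
    ∫ x, g x * (pairing ξ x : ℂ) ^ k * hermiteFun n x = 0 := by
  induction k generalizing n with
  | zero => simpa [coeff] using h0 n
  | succ k ih =>
    have hI := fun n => integrable_mul_pairing_pow_mul ξ n k hg hC
    have h1 : ∀ x, g x * (pairing ξ x : ℂ) ^ (k + 1) * hermiteFun n x = ∑ i,
        ((ξ i * √((n i : ℝ) / 2) : ℂ) *
            (g x * (pairing ξ x : ℂ) ^ k * hermiteFun (Function.update n i (n i - 1)) x) +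
          (ξ i * √(((n i : ℝ) + 1) / 2) : ℂ) *
            (g x * (pairing ξ x : ℂ) ^ k * hermiteFun (Function.update n i (n i + 1)) x)) := by
      intro x
      have h2 : (pairing ξ x : ℂ) = ∑ i, (ξ i : ℂ) * x i := by
        simp [pairing]
      calc g x * (pairing ξ x : ℂ) ^ (k + 1) * hermiteFun n x
          = (g x * (pairing ξ x : ℂ) ^ k * hermiteFun n x) * (pairing ξ x : ℂ) := by ring
        _ = ∑ i, (g x * (pairing ξ x : ℂ) ^ k * hermiteFun n x) * ((ξ i : ℂ) * x i) := by
            conv_lhs => rw [h2, Finset.mul_sum]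
            simp only [h2]
        _ = _ := by
            refine Finset.sum_congr rfl fun i _ => ?_
            linear_combination (g x * (pairing ξ x : ℂ) ^ k * ξ i) * mul_hermiteFun n i x
    simp only [h1]
    refine (integral_finsetSum _ fun i _ =>
      ((hI _).const_mul _).add ((hI _).const_mul _)).trans (Finset.sum_eq_zero fun i _ => ?_)
    refine (integral_add ((hI _).const_mul _) ((hI _).const_mul _)).trans ?_
    rw [integral_const_mul, integral_const_mul, ih, ih, mul_zero, mul_zero, add_zero]

lemma integral_mul_exp_mul_eq_zero {g : (Fin d → ℝ) → ℂ} (hg : Continuous g) {C : ℝ}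
    (hC : ∀ x, ‖g x‖ ≤ C) (h0 : ∀ n, coeff n g = 0) (ξ : Fin d → ℝ) (n : Fin d → ℕ) :
    ∫ x, Complex.exp (pairing ξ x * Complex.I) * (g x * hermiteFun n x) = 0 := by
  have h1 := continuous_pairing ξ
  have h2 := (contDiff_hermiteFun n).continuous
  have hC0 : 0 ≤ C := (norm_nonneg _).trans (hC 0)
  have hexp : ∀ x, HasSum (fun k : ℕ => C * ‖hermiteFun n x‖ * (|pairing ξ x| ^ k / k.factorial))
      (C * ‖hermiteFun n x‖ * Real.exp |pairing ξ x|) := fun x => by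
    rw [Real.exp_eq_exp_ℝ]
    exact (NormedSpace.expSeries_div_hasSum_exp |pairing ξ x|).mul_left _
  have hsum : HasSum (fun k : ℕ => ∫ x, (pairing ξ x * Complex.I) ^ k / (k.factorial : ℂ) *
      (g x * hermiteFun n x))
      (∫ x, Complex.exp (pairing ξ x * Complex.I) * (g x * hermiteFun n x)) := by
    refine hasSum_integral_of_dominated_convergence
      (fun k x => C * ‖hermiteFun n x‖ * (|pairing ξ x| ^ k / k.factorial))
      (fun k => Continuous.aestronglyMeasurable (by fun_prop))
      (fun k => Eventually.of_forall fun x => ?_) (Eventually.of_forall fun x => (hexp x).summable)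
      ?_ (Eventually.of_forall fun x => ?_)
    · rw [norm_mul, norm_mul, norm_div, norm_pow, norm_mul, Complex.norm_I, mul_one,
        Complex.norm_real, Real.norm_eq_abs, Complex.norm_natCast, mul_comm]
      gcongr
      exact hC x
    · simp only [fun x => (hexp x).tsum_eq]
      refine ((integrable_exp_pairing_mul ξ n).const_mul C).congr (Eventually.of_forall fun x => ?_)
      ring
    · rw [Complex.exp_eq_exp_ℂ]
      exact (NormedSpace.expSeries_div_hasSum_exp ((pairing ξ x : ℂ) * Complex.I)).mul_right _
  refine hsum.unique ?_
  convert hasSum_zero using 2 with k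
  have h3 : ∀ x, (pairing ξ x * Complex.I) ^ k / (k.factorial : ℂ) * (g x * hermiteFun n x) =
      (Complex.I ^ k / k.factorial) * (g x * (pairing ξ x : ℂ) ^ k * hermiteFun n x) := fun x => by
    ring
  simp only [h3]
  rw [integral_const_mul, integral_mul_pairing_pow_mul_eq_zero hg hC h0, mul_zero]

lemma hermiteFun_zero_ne_zero (x : Fin d → ℝ) : hermiteFun 0 x ≠ 0 := by
  rw [hermiteFun, Complex.ofReal_ne_zero, Finset.prod_ne_zero_iff]
  intro i _
  have : (√(√Real.pi))⁻¹ ≠ 0 := by positivity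
  simp [hermite₁, hermitePoly, this]

open scoped FourierTransform in
/-- A bounded continuous function that is orthogonal to all Hermite functions vanishes, since the
Fourier transform of its product with a Gaussian does. -/
theorem eq_zero_of_coeff_eq_zero {g : (Fin d → ℝ) → ℂ} (hg : Continuous g) {C : ℝ}
    (hC : ∀ x, ‖g x‖ ≤ C) (h0 : ∀ n, coeff n g = 0) (x : Fin d → ℝ) : g x = 0 := by
  set G : EuclideanSpace ℝ (Fin d) → ℂ := fun y => g y.ofLp * hermiteFun 0 y.ofLp with hG
  have hGc : Continuous G :=
    (hg.comp (PiLp.continuous_ofLp 2 _)).mul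
      ((contDiff_hermiteFun 0).continuous.comp (PiLp.continuous_ofLp 2 _))
  have hmp := PiLp.volume_preserving_ofLp (Fin d)
  have hme : MeasurableEmbedding (@WithLp.ofLp 2 (Fin d → ℝ)) :=
    (MeasurableEquiv.toLp 2 (Fin d → ℝ)).symm.measurableEmbedding
  have hGi : Integrable G :=
    (hmp.integrable_comp_emb hme).2 (integrable_mul_hermiteFun 0 hg hC)
  have hF : 𝓕 G = 0 := by
    funext w
    rw [Real.fourier_eq']
    have h1 := integral_mul_exp_mul_eq_zero hg hC h0 (fun i => -2 * Real.pi * w i) 0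
    rw [← hmp.integral_comp hme] at h1
    rw [Pi.zero_apply, ← h1]
    congr 1 with y
    rw [smul_eq_mul, hG]
    congr 3
    rw [pairing, PiLp.inner_apply, Finset.mul_sum]
    push_cast
    refine Finset.sum_congr rfl fun i _ => ?_
    simp only [RCLike.inner_apply, conj_trivial]
    push_cast
    ring
  have hinv := hGc.fourierInv_fourier_eq hGi (by rw [hF]; exact integrable_zero _ _ _)
  have h2 : G (WithLp.toLp 2 x) = 0 := by
    rw [← hinv, hF, Real.fourierInv_eq]
    simp
  exact (mul_eq_zero.1 h2).resolve_right (hermiteFun_zero_ne_zero x)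

lemma coeff_hermiteFun (n k : Fin d → ℕ) : coeff k (hermiteFun n) = if n = k then 1 else 0 := by
  have h1 : ∀ x : Fin d → ℝ, hermiteFun n x * hermiteFun k x =
      ((∏ i, (hermite₁ (n i) (x i) * hermite₁ (k i) (x i)) : ℝ) : ℂ) := fun x => by
    rw [hermiteFun, hermiteFun, Finset.prod_mul_distrib, Complex.ofReal_mul]
  rw [coeff]
  simp only [h1]
  rw [integral_complex_ofReal,
    integral_fintype_prod_volume_eq_prod fun i t => hermite₁ (n i) t * hermite₁ (k i) t]
  simp only [integral_hermite₁_mul]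
  split_ifs with h
  · simp [h]
  · obtain ⟨i, hi⟩ := Function.ne_iff.1 h
    rw [Finset.prod_eq_zero (Finset.mem_univ i) (if_neg hi), Complex.ofReal_zero]

/-- Pointwise convergence of Hermite expansions. -/
lemma hasSum_coeff_mul {f : (Fin d → ℝ) → ℂ} (hf : Continuous f) {C : ℝ} (hC : ∀ x, ‖f x‖ ≤ C)
    {b : (Fin d → ℕ) → ℝ} (hb : Summable b) (hfb : ∀ n x, ‖coeff n f * hermiteFun n x‖ ≤ b n)
    (x : Fin d → ℝ) : HasSum (fun n => coeff n f * hermiteFun n x) (f x) := by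
  have hs : ∀ x, Summable fun n => coeff n f * hermiteFun n x := fun x =>
    Summable.of_norm_bounded hb fun n => hfb n x
  set S : (Fin d → ℝ) → ℂ := fun x => ∑' n, coeff n f * hermiteFun n x with hS
  have hSc : Continuous S := continuous_tsum
    (fun n => continuous_const.mul (contDiff_hermiteFun n).continuous) hb hfb
  have hSb : ∀ x, ‖S x‖ ≤ ∑' n, b n := fun x => tsum_of_norm_bounded hb.hasSum fun n => hfb n x
  have hScoeff : ∀ k, coeff k S = coeff k f := by
    intro k
    have hk := (contDiff_hermiteFun k).continuous
    have h1 : HasSum (fun n => ∫ x, coeff n f * hermiteFun n x * hermiteFun k x) (coeff k S) := by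
      refine hasSum_integral_of_dominated_convergence (fun n x => b n * ‖hermiteFun k x‖)
        (fun n => ?_) (fun n => Eventually.of_forall fun x => ?_)
        (Eventually.of_forall fun x => hb.mul_right _) ?_
        (Eventually.of_forall fun x => (hs x).hasSum.mul_right _)
      · have hn := (contDiff_hermiteFun n).continuous
        exact Continuous.aestronglyMeasurable (by fun_prop)
      · rw [norm_mul]
        exact mul_le_mul_of_nonneg_right (hfb n x) (norm_nonneg _)
      · simp only [tsum_mul_right]
        exact (integrable_hermiteFun k).norm.const_mul _
    have h2 : ∀ n, ∫ x, coeff n f * hermiteFun n x * hermiteFun k x =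
        if n = k then coeff k f else 0 := fun n => by
      simp only [mul_assoc]
      rw [integral_const_mul]
      have := coeff_hermiteFun n k
      rw [coeff] at this
      rw [this]
      split_ifs with h
      · rw [h, mul_one]
      · rw [mul_zero]
    simp only [h2] at h1
    exact h1.unique (hasSum_ite_eq k (coeff k f))
  have hzero := eq_zero_of_coeff_eq_zero (hf.sub hSc) (C := C + ∑' n, b n)
    (fun x => (norm_sub_le _ _).trans (add_le_add (hC x) (hSb x))) (fun k => by
      have h1 : ∀ x, (f x - S x) * hermiteFun k x = f x * hermiteFun k x - S x * hermiteFun k x :=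
        fun x => sub_mul _ _ _
      change ∫ x, (f x - S x) * hermiteFun k x = 0
      simp only [h1]
      rw [integral_sub (integrable_mul_hermiteFun k hf hC) (integrable_mul_hermiteFun k hSc hSb)]
      exact sub_eq_zero.2 (hScoeff k).symm) x
  rw [sub_eq_zero.1 hzero]
  exact (hs x).hasSum

end completeness

/-! ### Series in the Gelfand-Shilov space -/

section series

variable {d : ℕ} {ι : Type*}

lemma pderiv_tsum (i : Fin d) {v : ι → (Fin d → ℝ) → ℂ} (hv : ∀ n, ContDiff ℝ ∞ (v n))
    {b : ι → ℝ} (hb : Summable b) (hvb : ∀ n x, ‖pderiv i (v n) x‖ ≤ b n)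
    (hs : ∀ x, Summable fun n => v n x) :
    pderiv i (fun x => ∑' n, v n x) = fun x => ∑' n, pderiv i (v n) x := by
  funext x
  have hline : ∀ n (t : ℝ), HasDerivAt (fun t : ℝ => v n (x + t • Pi.single i 1))
      (pderiv i (v n) (x + t • Pi.single i 1)) t := by
    intro n t
    have h1 := hasLineDerivAt_pderiv i (hv n) (x + t • Pi.single i 1)
    unfold HasLineDerivAt at h1
    have h2 : HasDerivAt (fun s : ℝ => v n (x + t • Pi.single i 1 + (s - t) • Pi.single i 1))
        (pderiv i (v n) (x + t • Pi.single i 1)) t :=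
      HasDerivAt.comp_sub_const t t (by rwa [sub_self])
    refine h2.congr_of_eventuallyEq (Eventually.of_forall fun s => ?_)
    dsimp only
    rw [add_assoc, ← add_smul, add_sub_cancel]
  have h3 := hasDerivAt_tsum (y₀ := (0 : ℝ)) hb hline (fun n t => hvb n _)
    (hs _) 0
  have h4 : pderiv i (fun x => ∑' n, v n x) x = _ := h3.deriv
  rw [h4]
  simp

lemma foldr_eq_mderiv (L P : List (Fin d)) (hL : List.finRange d = P ++ L) (γ : Fin d → ℕ)
    (f : (Fin d → ℝ) → ℂ) :
    L.foldr (fun i g => (pderiv i)^[γ i] g) f = mderiv (fun j => if j ∈ L then γ j else 0) f := by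
  have hnd := List.nodup_finRange d
  rw [hL] at hnd
  have hdis := List.disjoint_of_nodup_append hnd
  have hP : ∀ (P' : List (Fin d)) (h : (Fin d → ℝ) → ℂ), P' ⊆ P →
      P'.foldr (fun i g => (pderiv i)^[if i ∈ L then γ i else 0] g) h = h := by
    intro P' h
    induction P' with
    | nil => intro _; rfl
    | cons i P' ih =>
      intro hsub
      rw [List.foldr_cons, ih fun j hj => hsub (List.mem_cons_of_mem i hj),
        if_neg fun hi => hdis (hsub List.mem_cons_self) hi]
      rfl
  rw [mderiv, hL, List.foldr_append, hP P _ (List.Subset.refl P)]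
  exact List.foldr_ext _ _ _ fun i hi h => by rw [if_pos hi]

/-- Termwise differentiation. -/
lemma mderiv_tsum {u : ι → (Fin d → ℝ) → ℂ} (hu : ∀ n, ContDiff ℝ ∞ (u n))
    (hb : ∀ α : Fin d → ℕ, ∃ b : ι → ℝ, Summable b ∧ ∀ n x, ‖mderiv α (u n) x‖ ≤ b n)
    (α : Fin d → ℕ) :
    mderiv α (fun x => ∑' n, u n x) = fun x => ∑' n, mderiv α (u n) x := by
  have key : ∀ L P : List (Fin d), List.finRange d = P ++ L →
      L.foldr (fun i g => (pderiv i)^[α i] g) (fun x => ∑' n, u n x) =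
        fun x => ∑' n, L.foldr (fun i g => (pderiv i)^[α i] g) (u n) x := by
    intro L
    induction L with
    | nil => intro P _; rfl
    | cons i L ih =>
      intro P hP
      have hP' : List.finRange d = (P ++ [i]) ++ L := by rw [hP]; simp
      have hnd := List.nodup_finRange d
      rw [hP] at hnd
      have hiL : i ∉ L := (List.nodup_cons.1 hnd.of_append_right).1
      simp only [List.foldr_cons]
      rw [ih _ hP']
      set w := fun n => L.foldr (fun i g => (pderiv i)^[α i] g) (u n) with hw
      have hwc : ∀ n, ContDiff ℝ ∞ (w n) := fun n => foldr_contDiff α L (hu n)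
      -- the derivatives of the partially differentiated series are again of the form `u_n^(γ)`
      have hwb : ∀ a, ∃ b : ι → ℝ, Summable b ∧ ∀ n x, ‖(pderiv i)^[a] (w n) x‖ ≤ b n := by
        intro a
        obtain ⟨b, hbs, hbb⟩ :=
          hb fun j => if j ∈ i :: L then Function.update α i a j else 0
        refine ⟨b, hbs, fun n x => ?_⟩
        have hbb' := hbb n x
        rw [← foldr_eq_mderiv (i :: L) P hP (Function.update α i a)] at hbb'
        have h1 : (i :: L).foldr (fun j g => (pderiv j)^[Function.update α i a j] g) (u n) =
            (pderiv i)^[a] (w n) := by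
          rw [List.foldr_cons, Function.update_self, hw]
          congr 1
          refine List.foldr_ext _ _ _ fun j hj h => ?_
          rw [Function.update_of_ne (ne_of_mem_of_not_mem hj hiL)]
        rwa [h1] at hbb'
      have hiter : ∀ a, (pderiv i)^[a] (fun x => ∑' n, w n x) =
          fun x => ∑' n, (pderiv i)^[a] (w n) x := by
        intro a
        induction a with
        | zero => rfl
        | succ a iha =>
          obtain ⟨b, hbs, hbb⟩ := hwb a
          obtain ⟨b', hbs', hbb'⟩ := hwb (a + 1)
          simp only [Function.iterate_succ_apply'] at hbb' ⊢
          rw [iha]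
          exact pderiv_tsum i (fun n => iter_contDiff i a (hwc n)) hbs' hbb'
            fun x => Summable.of_norm_bounded hbs fun n => hbb n x
      exact hiter (α i)
  exact key _ [] rfl

lemma NormLE.norm_mderiv_le {M : WeightSequence} {m Q : ℝ} (hm : 0 < m) {f : (Fin d → ℝ) → ℂ}
    (h : NormLE M m Q f) (α β : Fin d → ℕ) (x : Fin d → ℝ) :
    wt β x * ‖mderiv α f x‖ ≤ Q * (M.seq (len α) * M.seq (len β) / m ^ (len α + len β)) := by
  have h1 := h α β x
  have p1 := M.seq_pos (len α)
  have p2 := M.seq_pos (len β)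
  rw [term, div_mul_eq_mul_div, div_le_iff₀ (by positivity), ← le_div_iff₀' (pow_pos hm _)] at h1
  rwa [← mul_div_assoc]

lemma NormLE.tsum {M : WeightSequence} {m : ℝ} (hm : 0 < m) {u : ι → (Fin d → ℝ) → ℂ}
    (hu : ∀ n, ContDiff ℝ ∞ (u n)) {b : ι → ℝ} (hb : Summable b)
    (h : ∀ n, NormLE M m (b n) (u n)) : NormLE M m (∑' n, b n) fun x => ∑' n, u n x := by
  intro α β x
  have h1 := mderiv_tsum hu (fun α => ⟨_, hb.mul_right _, fun n x =>
    (le_mul_of_one_le_left (norm_nonneg _) (one_le_wt 0 x)).trans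
      ((h n).norm_mderiv_le hm α 0 x)⟩) α
  have hn : Summable fun n => term M m (u n) α β x :=
    Summable.of_nonneg_of_le (fun n => term_nonneg M hm.le _ _ _ _) (fun n => h n α β x) hb
  have hpos : 0 < m ^ (len α + len β) / (M.seq (len α) * M.seq (len β)) * wt β x :=
    mul_pos (div_pos (pow_pos hm _) (mul_pos (M.seq_pos _) (M.seq_pos _)))
      (one_pos.trans_le (one_le_wt β x))
  have hn' : Summable fun n => ‖mderiv α (u n) x‖ := by
    refine (hn.mul_left (m ^ (len α + len β) / (M.seq (len α) * M.seq (len β)) * wt β x)⁻¹).congr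
      fun n => ?_
    rw [term, ← mul_assoc (m ^ (len α + len β) / (M.seq (len α) * M.seq (len β))),
      inv_mul_cancel_left₀ hpos.ne']
  calc term M m (fun x => ∑' n, u n x) α β x
      ≤ m ^ (len α + len β) / (M.seq (len α) * M.seq (len β)) * wt β x *
        ∑' n, ‖mderiv α (u n) x‖ := by
        rw [term, h1, ← mul_assoc]
        exact mul_le_mul_of_nonneg_left (norm_tsum_le_tsum_norm hn') hpos.le
    _ = ∑' n, term M m (u n) α β x := by
        rw [← tsum_mul_left]
        simp only [term, mul_assoc]
    _ ≤ ∑' n, b n := hn.tsum_le_tsum (fun n => h n α β x) hb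

/-- The Hermite functions as elements of the Gelfand-Shilov space. -/
noncomputable def hermiteSpace (M : WeightSequence) (n : Fin d → ℕ) : Space M d :=
  ⟨hermiteFun n, contDiff_hermiteFun n,
    let ⟨m, _, hm, h⟩ := exists_normLE_hermiteFun M n
    ⟨m, hm, h.ne_top⟩⟩

/-- The Hermite expansion of a function of the Gelfand-Shilov space converges to it in the topology
of this space. -/
theorem hasSum_coeff_smul_hermiteSpace {M : WeightSequence} (φ : Space M d) :
    HasSum (fun n => coeff n φ • hermiteSpace M n) φ := by
  obtain ⟨m, Q, hm, hQ⟩ := φ.exists_normLE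
  obtain ⟨m', C, hm', hC, h⟩ := exists_normLE_coeff_smul M hm d
  have hn := h φ.contDiff hQ
  have hb : Summable fun n : Fin d → ℕ => C * Q * decay n := summable_decay.mul_left _
  have hpt : ∀ x, HasSum (fun n => coeff n φ * hermiteFun n x) (φ x) :=
    hasSum_coeff_mul φ.contDiff.continuous hQ.norm_le hb fun n x => (hn n).norm_le x
  refine tendsto_of_normLE hm' (tendsto_tsum_compl_atTop_zero fun n => C * Q * decay n) fun s => ?_
  have hsub := NormLE.tsum hm' (u := fun n : {n // n ∉ s} => coeff n.1 φ • hermiteFun n.1)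
    (fun n => contDiff_const.smul (contDiff_hermiteFun n.1))
    (hb.comp_injective Subtype.val_injective) fun n => hn n.1
  have heq : ((φ - ∑ n ∈ s, coeff n φ • hermiteSpace M n : Space M d) : (Fin d → ℝ) → ℂ) =
      fun x => ∑' n : {n // n ∉ s}, (coeff n.1 φ • hermiteFun n.1) x := by
    funext x
    have h1 := (hpt x).summable.sum_add_tsum_subtype_compl s
    rw [(hpt x).tsum_eq] at h1
    rw [Space.coe_sub, Pi.sub_apply, Space.coe_sum, ← h1]
    exact add_sub_cancel_left (∑ n ∈ s, coeff n φ * hermiteFun n x) _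
  rw [← heq] at hsub
  have hneg := hsub.smul (Space.contDiff _) (-1)
  rw [norm_neg, norm_one, one_mul, ← Space.coe_smul, neg_one_smul, neg_sub] at hneg
  exact hneg

end series

/-! ### The kernel of a sequentially continuous map -/

section kernel

variable {M : WeightSequence} {d l s : ℕ}

lemma Space.integrable_mul_hermiteFun (φ : Space M d) (n : Fin d → ℕ) :
    MeasureTheory.Integrable fun x => φ x * hermiteFun n x :=
  let ⟨_, _, _, h⟩ := φ.exists_normLE
  GelfandShilov.integrable_mul_hermiteFun n φ.contDiff.continuous h.norm_le

lemma coeff_add (n : Fin d → ℕ) (φ ψ : Space M d) :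
    coeff n (φ + ψ : Space M d) = coeff n φ + coeff n ψ := by
  unfold coeff
  rw [← MeasureTheory.integral_add (φ.integrable_mul_hermiteFun n) (ψ.integrable_mul_hermiteFun n)]
  exact congrArg _ (funext fun x => add_mul (φ x) (ψ x) _)

lemma coeff_smul (n : Fin d → ℕ) (c : ℂ) (φ : Space M d) :
    coeff n (c • φ : Space M d) = c * coeff n φ := by
  unfold coeff
  rw [← MeasureTheory.integral_const_mul]
  exact congrArg _ (funext fun x => mul_assoc c (φ x) _)

/-- The linear span of the Hermite functions is dense. -/
lemma Dual.ext_hermiteSpace {K K' : Dual M d}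
    (h : ∀ n, K (hermiteSpace M n) = K' (hermiteSpace M n)) (φ : Space M d) : K φ = K' φ := by
  have h1 := (hasSum_coeff_smul_hermiteSpace φ).mapL K
  have h2 := (hasSum_coeff_smul_hermiteSpace φ).mapL K'
  simp only [map_smul, h] at h1 h2
  exact h1.unique h2

lemma tensor_hermiteSpace (n : Fin (l + s) → ℕ) :
    tensor (hermiteSpace M fun i => n (Fin.castAdd s i))
      (hermiteSpace M fun j => n (Fin.natAdd l j)) = hermiteSpace M n := by
  refine Space.ext fun x => ?_
  change tensorFun (hermiteFun _) (hermiteFun _) x = hermiteFun n x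
  simp only [tensorFun, hermiteFun]
  rw [Fin.prod_univ_add, Complex.ofReal_mul]

lemma NormLE.tensor {m Q R : ℝ} (hm : 0 < m) {ψ : Space M l} {φ : Space M s}
    (hψ : NormLE M m Q ψ) (hφ : NormLE M m R φ) : NormLE M m (Q * R) (tensor ψ φ) :=
  fun _ _ _ => (term_tensor_le M hm.le _ _ _ _ _).trans
    (mul_le_mul (hψ _ _ _) (hφ _ _ _) (term_nonneg M hm.le _ _ _ _) hψ.nonneg)

/-- The map `ψ ↦ ψ ⊗ φ`. -/
noncomputable def tensorLeft (φ : Space M s) : Space M l →ₗ[ℂ] Space M (l + s) where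
  toFun ψ := tensor ψ φ
  map_add' ψ ψ' := Space.ext fun _ => add_mul (ψ _) (ψ' _) _
  map_smul' c ψ := Space.ext fun _ => mul_assoc c (ψ _) _

/-- The map `φ ↦ ψ ⊗ φ`. -/
noncomputable def tensorRight (ψ : Space M l) : Space M s →ₗ[ℂ] Space M (l + s) where
  toFun φ := tensor ψ φ
  map_add' φ φ' := Space.ext fun _ => mul_add (ψ _) (φ _) (φ' _)
  map_smul' c φ := Space.ext fun _ => mul_left_comm (ψ _) c (φ _)

lemma continuous_comp_tensorLeft (K : Dual M (l + s)) (φ : Space M s) :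
    Continuous (K.toLinearMap ∘ₗ tensorLeft (l := l) φ) := by
  obtain ⟨m₀, R, hm₀, hR⟩ := φ.exists_normLE
  refine continuous_of_bounded _ fun m hm => ?_
  have hmin : 0 < min m m₀ := lt_min hm hm₀
  obtain ⟨C, hC, h⟩ := bounded_of_continuous K hmin
  refine ⟨C * R, mul_nonneg hC hR.nonneg, fun ψ Q hQ => (h _ _ (NormLE.tensor hmin
    (hQ.mono_index hmin.le (min_le_left _ _))
    (hR.mono_index hmin.le (min_le_right _ _)))).trans (le_of_eq (by ring))⟩

lemma continuous_comp_tensorRight (K : Dual M (l + s)) (ψ : Space M l) :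
    Continuous (K.toLinearMap ∘ₗ tensorRight (s := s) ψ) := by
  obtain ⟨m₀, R, hm₀, hR⟩ := ψ.exists_normLE
  refine continuous_of_bounded _ fun m hm => ?_
  have hmin : 0 < min m m₀ := lt_min hm hm₀
  obtain ⟨C, hC, h⟩ := bounded_of_continuous K hmin
  refine ⟨C * R, mul_nonneg hC hR.nonneg, fun φ Q hQ => (h _ _ (NormLE.tensor hmin
    (hR.mono_index hmin.le (min_le_right _ _))
    (hQ.mono_index hmin.le (min_le_left _ _)))).trans (le_of_eq (by ring))⟩

/-- The kernel is defined by its values on the Hermite functions, `K(h_n) = ⟨T h_{n''}, h_{n'}⟩`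
for `n = (n', n'')`; it is bounded on each Banach space because Hermite expansions converge
absolutely. -/
lemma exists_kernel_hermiteSpace (T : Space M s →ₗ[ℂ] Dual M l)
    (hT : ∀ m : ℝ, 0 < m → ∃ C : ℝ, 0 ≤ C ∧ ∀ (φ : Space M s) (ψ : Space M l) (Q R : ℝ),
      NormLE M m Q φ → NormLE M m R ψ → ‖T φ ψ‖ ≤ C * Q * R) :
    ∃ K : Dual M (l + s), ∀ n : Fin (l + s) → ℕ, K (hermiteSpace M n) =
      T (hermiteSpace M fun j => n (Fin.natAdd l j))
        (hermiteSpace M fun i => n (Fin.castAdd s i)) := by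
  set B : (Fin (l + s) → ℕ) → ℂ := fun n =>
    T (hermiteSpace M fun j => n (Fin.natAdd l j)) (hermiteSpace M fun i => n (Fin.castAdd s i))
  have hbound : ∀ m : ℝ, 0 < m → ∃ C : ℝ, 0 ≤ C ∧ ∀ (f : Space M (l + s)) (Q : ℝ),
      NormLE M m Q f → ∀ n, ‖coeff n f * B n‖ ≤ C * Q * decay n := by
    intro m hm
    obtain ⟨m', C, hm', hC, h⟩ := exists_normLE_coeff_smul M hm (l + s)
    obtain ⟨C', hC', h'⟩ := bounded_by_tensor T hT hm'
    refine ⟨C' * C, by positivity, fun f Q hQ n => ?_⟩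
    have h1 := h f.contDiff hQ n
    have h2 : coeff n f • hermiteFun n = (tensor
        (coeff n f • hermiteSpace M fun i => n (Fin.castAdd s i))
        (hermiteSpace M fun j => n (Fin.natAdd l j)) : (Fin (l + s) → ℝ) → ℂ) := by
      have h3 := map_smul (tensorLeft (hermiteSpace M fun j => n (Fin.natAdd l j))) (coeff n f)
        (hermiteSpace M fun i => n (Fin.castAdd s i))
      change tensor _ _ = coeff n f • tensor _ _ at h3
      rw [h3, tensor_hermiteSpace]
      rfl
    rw [h2] at h1
    have h4 := h' _ _ _ h1
    rw [map_smul, smul_eq_mul] at h4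
    exact h4.trans (le_of_eq (by ring))
  have hsum : ∀ f : Space M (l + s), Summable fun n => coeff n f * B n := fun f => by
    obtain ⟨m, Q, hm, hQ⟩ := f.exists_normLE
    obtain ⟨C, -, h⟩ := hbound m hm
    exact Summable.of_norm_bounded (summable_decay.mul_left _) (h f Q hQ)
  let K : Space M (l + s) →ₗ[ℂ] ℂ :=
    { toFun := fun f => ∑' n, coeff n f * B n
      map_add' := fun f g => by
        rw [← (hsum f).tsum_add (hsum g)]
        simp only [coeff_add, add_mul]
      map_smul' := fun c f => by
        rw [RingHom.id_apply, smul_eq_mul, ← tsum_mul_left]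
        simp only [coeff_smul, mul_assoc] }
  have hK : Continuous K := continuous_of_bounded K fun m hm => by
    obtain ⟨C, hC, h⟩ := hbound m hm
    refine ⟨C * ∑' n : Fin (l + s) → ℕ, decay n,
      mul_nonneg hC (tsum_nonneg decay_nonneg), fun f Q hQ => ?_⟩
    refine (tsum_of_norm_bounded (summable_decay.mul_left _).hasSum (h f Q hQ)).trans (le_of_eq ?_)
    rw [tsum_mul_left]
    ring
  refine ⟨⟨K, hK⟩, fun n => ?_⟩
  change ∑' k, coeff k (hermiteFun n) * B k = B n
  rw [tsum_eq_single n fun k hk => by rw [coeff_hermiteFun, if_neg hk.symm, zero_mul],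
    coeff_hermiteFun, if_pos rfl, one_mul]

/-- A map into the dual whose bilinear functional is bounded on the products of the Banach spaces of
each index has a unique kernel. -/
theorem existsUnique_kernel (T : Space M s →ₗ[ℂ] Dual M l)
    (hT : ∀ m : ℝ, 0 < m → ∃ C : ℝ, 0 ≤ C ∧ ∀ (φ : Space M s) (ψ : Space M l) (Q R : ℝ),
      NormLE M m Q φ → NormLE M m R ψ → ‖T φ ψ‖ ≤ C * Q * R) :
    ∃! K : Dual M (l + s), ∀ (φ : Space M s) (ψ : Space M l), T φ ψ = K (tensor ψ φ) := by
  obtain ⟨K, hK⟩ := exists_kernel_hermiteSpace T hT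
  refine ⟨K, fun φ ψ => ?_, fun K' hK' => ContinuousLinearMap.ext <|
    Dual.ext_hermiteSpace fun n => ?_⟩
  · -- by density in each variable separately, Hermite functions suffice
    have h1 : ∀ (k : Fin s → ℕ) (ψ : Space M l),
        T (hermiteSpace M k) ψ = K (tensor ψ (hermiteSpace M k)) := fun k ψ =>
      Dual.ext_hermiteSpace (K := T (hermiteSpace M k))
        (K' := ⟨_, continuous_comp_tensorLeft K (hermiteSpace M k)⟩) (fun n => by
          have h2 := hK (Fin.append n k)
          rw [← tensor_hermiteSpace] at h2
          simp only [Fin.append_left, Fin.append_right] at h2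
          exact h2.symm) ψ
    have hTψ : Continuous ((ContinuousLinearMap.coeLM ℂ ∘ₗ T).flip ψ) := by
      obtain ⟨m₀, R, hm₀, hR⟩ := ψ.exists_normLE
      refine continuous_of_bounded _ fun m hm => ?_
      have hmin : 0 < min m m₀ := lt_min hm hm₀
      obtain ⟨C, hC, h⟩ := hT _ hmin
      exact ⟨C * R, mul_nonneg hC hR.nonneg, fun φ Q hQ => (h φ ψ Q R
        (hQ.mono_index hmin.le (min_le_left _ _))
        (hR.mono_index hmin.le (min_le_right _ _))).trans (le_of_eq (by ring))⟩
    exact Dual.ext_hermiteSpace (K := ⟨_, hTψ⟩) (K' := ⟨_, continuous_comp_tensorRight K ψ⟩)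
      (fun k => h1 k ψ) φ
  · rw [hK n, ← tensor_hermiteSpace]
    exact (hK' _ _).symm

end kernel

end GelfandShilov

theorem mainTheorem2 (M : GelfandShilov.WeightSequence) (l s : ℕ) :
    (∀ K : GelfandShilov.Space M l →ₗ[ℂ] GelfandShilov.Space M s →ₗ[ℂ] ℂ,
      Continuous (fun p : GelfandShilov.Space M l × GelfandShilov.Space M s => K p.1 p.2) →
      ∃! T : GelfandShilov.Space M s →ₗ[ℂ] GelfandShilov.Dual M l,
        (∀ (φ : GelfandShilov.Space M s) (ψ : GelfandShilov.Space M l), T φ ψ = K ψ φ) ∧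
        Continuous T ∧
        ∀ u : ℕ → GelfandShilov.Space M s,
          Tendsto u atTop (𝓝 0) → Tendsto (fun j => T (u j)) atTop (𝓝 0)) ∧
    (∀ T : GelfandShilov.Space M s →ₗ[ℂ] GelfandShilov.Dual M l,
      (∀ u : ℕ → GelfandShilov.Space M s,
        Tendsto u atTop (𝓝 0) → Tendsto (fun j => T (u j)) atTop (𝓝 0)) →
      ∃! K : GelfandShilov.Dual M (l + s),
        ∀ (φ : GelfandShilov.Space M s) (ψ : GelfandShilov.Space M l),
          T φ ψ = K (GelfandShilov.tensor ψ φ)) :=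
  ⟨GelfandShilov.existsUnique_of_continuous, fun T hT =>
    GelfandShilov.existsUnique_kernel T fun _ hm => GelfandShilov.bounded_of_seqContinuous T hT hm⟩
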